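/- **Setting.** Let $\mathcal N$ be a finite non-empty ground set with $|\mathcal N|=n$, let $f:2^{\mathcal N}\to\mathbb R_{\ge 0}$ be submodular (not necessarily monotone), i.e. $f(X)+f(Y)\ge f(X\cup Y)+f(X\cap Y)$, and let $B\ge 1$ be a real number. Put $\mathcal I=\{X\subseteq\mathcal N: |X|\le B\}$, $r=\max_{X\in\mathcal I}|X|$, $\mathrm{OPT}=\max_{X\in\mathcal I}f(X)$, and $f(u\mid X)=f(X\cup\{u\})-f(X)$. The function $f$ is accessed through a value oracle; an adaptive round is a batch of oracle queries, polynomially many in $n$, that depend only on the answers of previous rounds. The adaptivity of an algorithm is the expected number of its adaptive rounds, and its query complexity is the expected total number of its oracle queries. **The algorithm** $\mathsf{ParSSP}(p,\epsilon)$, for $0<\epsilon<1$ and $p\in(0,1]$. Let $M=\lceil(\log_{1-\epsilon}(\epsilon/r)+2)/\epsilon^{2}\rceil$, $\ell=\lceil\log_{1-\epsilon}(\epsilon/r)\rceil+1$, $u^*\in\arg\max_{u\in\mathcal N}f(\{u\})$, $T=\emptyset$, $I=\mathcal N$. For $i=1,\dots,\ell$, put $\rho_i=f(\{u^*\})(1-\epsilon)^{i-1}$,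 compute $(A,U,L)=\mathsf{RandBatch}(\rho_i,T,I)$, and set $T\leftarrow T\cup A$, $I\leftarrow I\setminus(U\cup L)$. Return the set $S\in\{T,\{u^*\}\}$ with the larger value of $f$. $\mathsf{RandBatch}(\rho,T,I)$: start with $A=U=\emptyset$, $count=0$ and $L=\{u\in I: f(u\mid T)\ge\rho,\ T\cup\{u\}\in\mathcal I\}$. While $L\ne\emptyset$ and $count<M$, do the following. 1. Draw a random sequence $(v_1,\dots,v_d)$ as follows. Start with the empty sequence and $J=L$; while $J\neq\emptyset$, permute $J$ uniformly at random, append to the sequence the longest prefix of the permuted $J$ that keeps the union of $T\cup A$ and the sequence in $\mathcal I$, and remove from $J$ all elements that are in the sequence or can no longer be added. 2. For $0\le i\le d$ let $G_i=T\cup A\cup\{v_1,\dots,v_i\}$, $E_i^+=\{u\in L: f(u\mid G_i)\ge\rho,\ G_i\cup\{u\}\in\mathcal I\}$, $E_i^-=\{u\in L: f(u\mid G_i)<0\}$ and $D_i=\{v_j: j\le i,\ f(v_j\mid G_{j-1})<0\}$. 3. Let $t_1$ be the least $i\in\{1,\dots,d\}$ with $|E_i^+|\le(1-\epsilon)|L|$,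 let $t_2$ be the least $i\in\{1,\dots,d\}$ with $\epsilon\sum_{u\in E_i^+}f(u\mid G_i)\le\sum_{u\in E_i^-}|f(u\mid G_i)|+\sum_{v_j\in D_i}|f(v_j\mid G_{j-1})|$ (each is $d+1$ if there is no such $i$), and let $t^*=\min\{t_1,t_2\}$. Add $v_1,\dots,v_{t^*}$ to $U$. 4. With probability $p$, add $v_1,\dots,v_{t^*}$ to $A$ and, if $t_2<t_1$, increase $count$ by one. 5. Replace $L$ by $\{u\in L\setminus U: f(u\mid T\cup A)\ge\rho,\ T\cup A\cup\{u\}\in\mathcal I\}$. Finally return $(A,U,L)$. The indices $t_1,t_2$ are found either (a) by evaluating all indices $i$ in one adaptive round, or (b) by binary search. **Theorem.** Let $0<\epsilon<1$. There is a constant $C>0$ that depends only on $\epsilon$ such that, for all $\mathcal N$, $f$ and $B$ as above, $\mathsf{ParSSP}$ with $p=1/2$, in either variant, always returns a set $S\in\mathcal I$, makes at most $(n+1)^2$ oracle queries in each adaptive round, and satisfies $$\mathbb E[f(S)]\ \ge\ \left(\tfrac14-\epsilon\right)\mathrm{OPT}.$$ Moreover, in variant (a) its adaptivity is at most $C\log^2(n+1)$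 and its query complexity at most $C\,nr\log^2(n+1)$; in variant (b) its adaptivity is at most $C\log^2(n+1)\log(r+1)$ and its query complexity at most $C\,n\log^2(n+1)\log(r+1)$. -/

import Mathlib

open Finset

noncomputable section

namespace LowAdaptivity

universe u v w

/-! ### Submodular functions and constraints -/

/-- Submodularity of a set function on a finite ground set. -/
def IsSubmodular {α : Type u} [DecidableEq α] (f : Finset α → ℝ) : Prop :=
  ∀ X Y : Finset α, f (X ∪ Y) + f (X ∩ Y) ≤ f X + f Y

/-- The feasible sets of the cardinality constraint `|X| ≤ B`. -/
def cardFamily (α : Type u) [Fintype α] [DecidableEq α] (B : ℝ) : Finset (Finset α) :=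
  (univ : Finset (Finset α)).filter fun X => (X.card : ℝ) ≤ B

/-- The maximum cardinality of a feasible set. -/
def rank {α : Type u} (𝓘 : Finset (Finset α)) : ℕ := 𝓘.sup Finset.card

/-- The optimal value `max {f X | X ∈ 𝓘}` (a maximum over a finite family). -/
def optValue {α : Type u} (𝓘 : Finset (Finset α)) (f : Finset α → ℝ) : ℝ :=
  sSup (f '' (𝓘 : Set (Finset α)))

/-! ### Randomized algorithms with a value oracle -/

/-- A randomized algorithm that accesses a set function on `α` only through a value oracle and
returns an element of `β`.  A node `query Q k` is one adaptive round: all the sets in `Q` are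
submitted together, and the continuation `k` receives the answers (see `OracleAlg.law`).
A node `coin p k` flips a coin that shows `true` with probability `p`;
a node `shuffle X k` draws a uniformly random ordering of `X`. -/
inductive OracleAlg (α : Type u) (β : Type v) : Type (max u v)
  | ret (b : β) : OracleAlg α β
  | query (Q : Finset (Finset α)) (k : (Finset α → ℝ) → OracleAlg α β) : OracleAlg α β
  | coin (p : unitInterval) (k : Bool → OracleAlg α β) : OracleAlg α β
  | shuffle (X : Finset α) (k : List α → OracleAlg α β) : OracleAlg α β

/-- The cost of one run: the number of adaptive rounds, the total number of oracle queries, and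
the largest number of queries made in a single round. -/
structure Cost where
  rounds : ℕ
  queries : ℕ
  maxBatch : ℕ

/-- The law of a coin that shows `true` with probability `p`. -/
def coinLaw (p : unitInterval) : PMF Bool :=
  PMF.ofFintype
    (fun b => if b then ENNReal.ofReal (p : ℝ) else ENNReal.ofReal (1 - (p : ℝ)))
    (by
      have h0 : (0 : ℝ) ≤ p := p.2.1
      have h1 : (0 : ℝ) ≤ 1 - (p : ℝ) := sub_nonneg.mpr p.2.2
      simp [← ENNReal.ofReal_add h0 h1])

/-- The uniform law on the orderings of `X`. -/
def shuffleLaw {α : Type u} [DecidableEq α] (X : Finset α) : PMF (List α) :=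
  PMF.uniformOfFinset X.toList.permutations.toFinset
    ⟨X.toList, by simp⟩

namespace OracleAlg

variable {α : Type u} {β : Type v} {γ : Type w}

/-- Sequential composition. -/
def bind : OracleAlg α β → (β → OracleAlg α γ) → OracleAlg α γ
  | ret b, h => h b
  | query Q k, h => query Q fun g => (k g).bind h
  | coin p k, h => coin p fun b => (k b).bind h
  | shuffle X k, h => shuffle X fun l => (k l).bind h

/-- The joint law of the output and the cost of a run with oracle `f`.  After the query of the
batch `Q` the algorithm is told the values of `f` on `Q` and nothing else about `f`. -/
def law [DecidableEq α] (f : Finset α → ℝ) : OracleAlg α β → PMF (β × Cost)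
  | ret b => PMF.pure (b, ⟨0, 0, 0⟩)
  | query Q k =>
      (law f (k fun X => if X ∈ Q then f X else 0)).map fun x =>
        (x.1, ⟨x.2.rounds + 1, x.2.queries + Q.card, max x.2.maxBatch Q.card⟩)
  | coin p k => (coinLaw p).bind fun b => law f (k b)
  | shuffle X k => (shuffleLaw X).bind fun l => law f (k l)

end OracleAlg

/-- The expectation of `φ` under `μ` (all the laws of this file have finite support). -/
def expect {β : Type v} (μ : PMF β) (φ : β → ℝ) : ℝ := ∑' x, (μ x).toReal * φ x

/-! ### The algorithm

All procedures take the family `𝓘` of feasible sets; every element has cost `1`, so `c(X) = |X|`.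
A set function `g` below is always the table of oracle answers of the latest round. -/

section Algorithm

variable {α : Type u} [DecidableEq α]

/-- The marginal gain `g(u | X)`. -/
def gain (g : Finset α → ℝ) (X : Finset α) (u : α) : ℝ := g (insert u X) - g X

/-- The elements of `L` that can be added to `X` with marginal gain at least `ρ`. -/
def valuable (𝓘 : Finset (Finset α)) (ρ : ℝ) (g : Finset α → ℝ) (X L : Finset α) : Finset α :=
  L.filter fun u => ρ ≤ gain g X u ∧ insert u X ∈ 𝓘

/-- The elements of `L` with negative marginal gain with respect to `X`. -/
def negative (g : Finset α → ℝ) (X L : Finset α) : Finset α :=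
  L.filter fun u => gain g X u < 0

/-- `G_i = X ∪ {v_1, …, v_i}`. -/
def prefixSet (X : Finset α) (V : List α) (i : ℕ) : Finset α := X ∪ (V.take i).toFinset

/-- The sum of `|g(v_j | G_{j-1})|` over those `j ≤ i` for which `g(v_j | G_{j-1}) < 0`. -/
def dropSum (g : Finset α → ℝ) (X : Finset α) (V : List α) (i : ℕ) : ℝ :=
  ∑ j ∈ (range i).filter
      (fun j => g (prefixSet X V (j + 1)) - g (prefixSet X V j) < 0),
    |g (prefixSet X V (j + 1)) - g (prefixSet X V j)|

/-- The condition that defines `t₁`: `c(E_i⁺) ≤ (1 - ε) c(L)`. -/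
def costCond (𝓘 : Finset (Finset α)) (ρ ε : ℝ) (g : Finset α → ℝ) (X : Finset α) (V : List α)
    (L : Finset α) (i : ℕ) : Prop :=
  ((valuable 𝓘 ρ g (prefixSet X V i) L).card : ℝ) ≤ (1 - ε) * (L.card : ℝ)

/-- The condition that defines `t₂`. -/
def valueCond (𝓘 : Finset (Finset α)) (ρ ε : ℝ) (g : Finset α → ℝ) (X : Finset α) (V : List α)
    (L : Finset α) (i : ℕ) : Prop :=
  ε * ∑ u ∈ valuable 𝓘 ρ g (prefixSet X V i) L, gain g (prefixSet X V i) u ≤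
    ∑ u ∈ negative g (prefixSet X V i) L, |gain g (prefixSet X V i) u| + dropSum g X V i

/-- The sets whose values decide `costCond` and `valueCond` at the index `i`. -/
def probeSets (X : Finset α) (V : List α) (L : Finset α) (i : ℕ) : Finset (Finset α) :=
  (range (i + 1)).image (prefixSet X V) ∪ L.image fun u => insert u (prefixSet X V i)

/-- The least `i ∈ {1, …, d}` with `P i`, and `d + 1` if there is none. -/
def firstIndex (d : ℕ) (P : ℕ → Prop) : ℕ := sInf {i | 1 ≤ i ∧ (P i ∨ d < i)}

/-- Binary search for the least index in `[lo, hi]` that passes a monotone test, where `hi` is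
known to be admissible and is never tested. -/
def bsearch (test : ℕ → OracleAlg α Bool) (lo hi : ℕ) : OracleAlg α ℕ :=
  if _h : lo < hi then
    (test ((lo + hi) / 2)).bind fun b =>
      if b then bsearch test lo ((lo + hi) / 2) else bsearch test ((lo + hi) / 2 + 1) hi
  else .ret lo
termination_by hi - lo
decreasing_by all_goals omega

/-- The two ways to find `t₁` and `t₂`: by evaluating all the indices in one round, or by binary
search. -/
inductive SearchMode
  | exhaustive
  | binary

open Classical in
/-- The pair `(t₁, t₂)` for the current solution `X`, the sequence `V` and the candidates `L`. -/
def findIndices (mode : SearchMode) (𝓘 : Finset (Finset α)) (ρ ε : ℝ) (X : Finset α)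
    (V : List α) (L : Finset α) : OracleAlg α (ℕ × ℕ) :=
  match mode with
  | .exhaustive =>
      .query ((range (V.length + 1)).biUnion (probeSets X V L)) fun g =>
        .ret (firstIndex V.length (costCond 𝓘 ρ ε g X V L),
          firstIndex V.length (valueCond 𝓘 ρ ε g X V L))
  | .binary =>
      (bsearch (fun i => .query (probeSets X V L i) fun g =>
          .ret (decide (costCond 𝓘 ρ ε g X V L i))) 1 (V.length + 1)).bind fun t₁ =>
      (bsearch (fun i => .query (probeSets X V L i) fun g =>
          .ret (decide (valueCond 𝓘 ρ ε g X V L i))) 1 (V.length + 1)).bind fun t₂ =>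
      .ret (t₁, t₂)

/-- The loop of `GetSEQ`, with a bound on the number of passes as first argument. -/
def getSeqLoop (𝓘 : Finset (Finset α)) (X : Finset α) :
    ℕ → List α → Finset α → OracleAlg α (List α)
  | 0, V, _ => .ret V
  | m + 1, V, I =>
      if I = ∅ then .ret V
      else .shuffle I fun l =>
        let s := Nat.findGreatest
          (fun i => X ∪ V.toFinset ∪ (l.take i).toFinset ∈ 𝓘) l.length
        let V' := V ++ l.take s
        getSeqLoop 𝓘 X m V'
          (I.filter fun u => u ∉ V' ∧ insert u (X ∪ V'.toFinset) ∈ 𝓘)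

/-- `GetSEQ`: a random sequence of elements of `I` that can be added to `X` together.  It is called
only when each element of `I` can be added to `X`; then each pass of the loop removes an element
of `I`, so that the bound `|I|` on the number of passes is no restriction. -/
def getSeq (𝓘 : Finset (Finset α)) (X I : Finset α) : OracleAlg α (List α) :=
  getSeqLoop 𝓘 X I.card [] I

/-- One round of queries that computes the valuable elements of `L` with respect to `X`. -/
def queryValuable (𝓘 : Finset (Finset α)) (ρ : ℝ) (X L : Finset α) :
    OracleAlg α (Finset α) :=
  .query (insert X (L.image fun u => insert u X)) fun g => .ret (valuable 𝓘 ρ g X L)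

/-- The loop of `RandBatch` on the function `f_T` and the sets feasible together with `T`.  The
state is `(A, U, L, count)`, and the first argument bounds the number of iterations. -/
def randBatchLoop (mode : SearchMode) (𝓘 : Finset (Finset α)) (ρ ε : ℝ) (p : unitInterval)
    (M : ℕ) (T : Finset α) :
    ℕ → Finset α → Finset α → Finset α → ℕ →
      OracleAlg α (Finset α × Finset α × Finset α)
  | 0, A, U, L, _ => .ret (A, U, L)
  | m + 1, A, U, L, count =>
      if L = ∅ ∨ M ≤ count then .ret (A, U, L)
      else
        (getSeq 𝓘 (T ∪ A) L).bind fun V =>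
        (findIndices mode 𝓘 ρ ε (T ∪ A) V L).bind fun t =>
        let W : Finset α := (V.take (min t.1 t.2)).toFinset
        .coin p fun b =>
          let A' := if b then A ∪ W else A
          let count' := if b ∧ t.2 < t.1 then count + 1 else count
          (queryValuable 𝓘 ρ (T ∪ A') (L \ (U ∪ W))).bind fun L' =>
            randBatchLoop mode 𝓘 ρ ε p M T m A' (U ∪ W) L' count'

/-- `RandBatch` with threshold `ρ` and candidates `I`, on the function `f_T(Y) = f(T ∪ Y)` and the
constraint `T ∪ Y ∈ 𝓘`.  It returns `(A, U, L)`.  As `min t₁ t₂ ≥ 1`, each iteration removes an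
element of `L ⊆ I`, so that the bound `|I|` on the number of iterations is no restriction. -/
def randBatch (mode : SearchMode) (𝓘 : Finset (Finset α)) (ρ ε : ℝ) (p : unitInterval) (M : ℕ)
    (T I : Finset α) : OracleAlg α (Finset α × Finset α × Finset α) :=
  (queryValuable 𝓘 ρ T I).bind fun L =>
    randBatchLoop mode 𝓘 ρ ε p M T I.card ∅ ∅ L 0

/-- The loop of `ParSSP` over the thresholds `ρmax (1 - ε)^j`; the first argument is the number of
thresholds that are still to be used. -/
def parSSPLoop (mode : SearchMode) (𝓘 : Finset (Finset α)) (ρmax ε : ℝ) (p : unitInterval)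
    (M : ℕ) : ℕ → ℕ → Finset α → Finset α → OracleAlg α (Finset α)
  | 0, _, T, _ => .ret T
  | m + 1, j, T, I =>
      (randBatch mode 𝓘 (ρmax * (1 - ε) ^ j) ε p M T I).bind fun R =>
        parSSPLoop mode 𝓘 ρmax ε p M m (j + 1) (T ∪ R.1) (I \ (R.2.1 ∪ R.2.2))

/-- A maximizer of a real function on a finite nonempty type. -/
def argmax [Finite α] [Nonempty α] (h : α → ℝ) : α := Classical.choose (Finite.exists_max h)

/-- `ParSSP` for the constraint family `𝓘` on the ground set `α`. -/
def parSSP [Fintype α] [Nonempty α] (mode : SearchMode) (𝓘 : Finset (Finset α))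
    (p : unitInterval) (ε : ℝ) : OracleAlg α (Finset α) :=
  let lg : ℝ := Real.logb (1 - ε) (ε / (rank 𝓘 : ℝ))
  let M : ℕ := ⌈(lg + 2) / ε ^ 2⌉₊
  let ell : ℕ := ⌈lg⌉₊ + 1
  .query (univ.image fun u : α => ({u} : Finset α)) fun g =>
    let uStar : α := argmax fun u => g {u}
    (parSSPLoop mode 𝓘 (g {uStar}) ε p M ell 0 ∅ univ).bind fun T =>
      .query {T, {uStar}} fun g' => .ret (if g' {uStar} ≤ g' T then T else {uStar})

end Algorithm

/-- The probability `1/2`. -/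
def oneHalf : unitInterval := ⟨1 / 2, by norm_num, by norm_num⟩

end LowAdaptivity

end

/-! Let `O` be optimal, `S` the output of the threshold loop and `y = (1-ε)⁻³`. Two estimates carry
the guarantee.

Lower bound on `E f(O ∪ S)`. Every element enters at most one batch, and a batch is accepted with
probability 1/2, so each element lies in `S` with probability at most 1/2
(`mean_parSSPLoop_mem_le`). For a nonnegative submodular function these marginal probabilities
alone, whatever the correlations, give `E f(O ∪ S) ≥ f(O)/2` (`le_mean_of_prob_le`).

Upper bound on `E [f(O ∪ S) - f(S)]` by `y E f(S)` plus small losses (`le_mean_parSSPLoop`). This is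
a charging argument. At threshold `ρ` no candidate has gain above `ρ/(1-ε)`, because it survived the
previous threshold. Rejecting a batch `W` charges `|W ∩ O| ρ/(1-ε)`; accepting it reserves `|W \ O|
ρ/(1-ε)`, which pays for the unused elements of `O` if the solution becomes full. The coin is fair,
so both together cost half of `|W| ρ/(1-ε)`, while the expected increase of `f` is at least half of
`(1-ε)² ρ E|W|`; the quotient is `y`. That increase is an optional-stopping statement: up to the
stopping index the remaining candidates have average gain at least `(1-ε)² ρ` (`sum_gain_nonneg`,
`sum_batch_gain_nonneg`).

Two losses remain. Candidates discarded because `count` reached `M` have total gain at most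
`OPT/(εM)`: each counted batch widens a gap between two values of `f` by `ε` times the current total
gain (`BatchInv`). Elements left after the last threshold have total gain at most `ε f({u*})`.
Altogether `(y + 1 + ε) E f(result) ≥ (1/2 - ε) OPT`, and `ratio_bound` turns this into the factor
`1/4 - ε`.

For the costs, an accepted iteration shrinks `L` by the factor `1-ε`, raises `count`, or ends the
call. Hence a potential of order `log n + M` drops by 1 with probability 1/2 per iteration
(`potential_accept_le`), and there are `O(log n)` thresholds. Binary search finds the same indices
because both stopping conditions are monotone (`costCond_mono`, `valueCond_mono`). -/

namespace LowAdaptivity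

universe u v w

/-! ### Expectations under laws with finite support -/

section Expect

variable {β : Type u} {γ : Type v}

lemma expect_eq_sum {μ : PMF β} {s : Finset β} (hs : μ.support ⊆ s) (φ : β → ℝ) :
    expect μ φ = ∑ x ∈ s, (μ x).toReal * φ x := by
  unfold expect
  refine tsum_eq_sum fun x hx => ?_
  have : μ x = 0 := by
    rw [PMF.apply_eq_zero_iff]
    exact fun h => hx (hs h)
  simp [this]

lemma expect_pure (b : β) (φ : β → ℝ) : expect (PMF.pure b) φ = φ b := by
  classical
  rw [expect_eq_sum (s := {b}) (by simp)]
  simp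

/-- Finite supports turn the series into finite sums, which can be exchanged without summability
conditions on `φ`. -/
lemma expect_bind {μ : PMF β} {ν : β → PMF γ} (hμ : μ.support.Finite)
    (hν : ∀ a ∈ μ.support, (ν a).support.Finite) (φ : γ → ℝ) :
    expect (μ.bind ν) φ = expect μ fun a => expect (ν a) φ := by
  classical
  have hfin : (μ.bind ν).support.Finite := by
    rw [PMF.support_bind]
    exact hμ.biUnion hν
  rw [expect_eq_sum (s := hfin.toFinset) (by simp), expect_eq_sum (s := hμ.toFinset) (by simp)]
  have h1 : ∀ a ∈ hμ.toFinset, (μ a).toReal * expect (ν a) φ =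
      ∑ x ∈ hfin.toFinset, (μ a).toReal * ((ν a x).toReal * φ x) := by
    intro a ha
    rw [expect_eq_sum (s := hfin.toFinset), Finset.mul_sum]
    intro x hx
    simp only [Set.Finite.coe_toFinset, PMF.support_bind, Set.mem_iUnion]
    exact ⟨a, by simpa using ha, hx⟩
  rw [Finset.sum_congr rfl h1, Finset.sum_comm]
  refine Finset.sum_congr rfl fun x _ => ?_
  have h2 : (μ.bind ν) x = ∑ a ∈ hμ.toFinset, μ a * ν a x := by
    rw [PMF.bind_apply]
    refine tsum_eq_sum fun a ha => ?_
    have : μ a = 0 := by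
      rw [PMF.apply_eq_zero_iff]
      exact fun h => ha (by simpa using h)
    simp [this]
  rw [h2, ENNReal.toReal_sum fun a _ => ENNReal.mul_ne_top (PMF.apply_ne_top _ _)
    (PMF.apply_ne_top _ _), Finset.sum_mul]
  refine Finset.sum_congr rfl fun a _ => ?_
  rw [ENNReal.toReal_mul, mul_assoc]

lemma expect_map {μ : PMF β} (hμ : μ.support.Finite) (g : β → γ) (φ : γ → ℝ) :
    expect (μ.map g) φ = expect μ fun a => φ (g a) := by
  rw [← PMF.bind_pure_comp, expect_bind hμ fun a _ => by simp]
  simp [expect_pure]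

lemma expect_coinLaw (p : unitInterval) (φ : Bool → ℝ) :
    expect (coinLaw p) φ = p * φ true + (1 - p) * φ false := by
  have h1 : (0 : ℝ) ≤ 1 - (p : ℝ) := sub_nonneg.mpr p.2.2
  rw [expect_eq_sum (s := univ) fun _ _ => by simp]
  simp [coinLaw, PMF.ofFintype_apply, ENNReal.toReal_ofReal p.2.1, ENNReal.toReal_ofReal h1]

end Expect

/-! ### Orderings of a finite set -/

/-- The orderings of `X`. -/
noncomputable def orderings {α : Type u} [DecidableEq α] (X : Finset α) : Finset (List α) :=
  X.toList.permutations.toFinset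

lemma mem_orderings {α : Type u} [DecidableEq α] {X : Finset α} {l : List α} :
    l ∈ orderings X ↔ l.Nodup ∧ l.toFinset = X := by
  simp only [orderings, List.mem_toFinset, List.mem_permutations]
  constructor
  · intro h
    exact ⟨h.nodup_iff.mpr X.nodup_toList, by rw [List.toFinset_eq_of_perm _ _ h]; simp⟩
  · rintro ⟨h1, rfl⟩
    refine (List.perm_ext_iff_of_nodup h1 (Finset.nodup_toList _)).mpr fun a => ?_
    simp

lemma orderings_nonempty {α : Type u} [DecidableEq α] (X : Finset α) : (orderings X).Nonempty :=
  ⟨X.toList, by simp [orderings]⟩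

lemma orderings_card_pos {α : Type u} [DecidableEq α] (X : Finset α) :
    (0 : ℝ) < (orderings X).card := by
  exact_mod_cast (orderings_nonempty X).card_pos

lemma shuffleLaw_eq {α : Type u} [DecidableEq α] (X : Finset α) :
    shuffleLaw X = PMF.uniformOfFinset (orderings X) (orderings_nonempty X) := rfl

lemma support_shuffleLaw {α : Type u} [DecidableEq α] (X : Finset α) :
    (shuffleLaw X).support = orderings X := by
  rw [shuffleLaw_eq, PMF.support_uniformOfFinset]

lemma expect_shuffleLaw {α : Type u} [DecidableEq α] (X : Finset α) (φ : List α → ℝ) :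
    expect (shuffleLaw X) φ = (∑ l ∈ orderings X, φ l) / (orderings X).card := by
  rw [expect_eq_sum (s := orderings X) (support_shuffleLaw X).subset,
    Finset.sum_div]
  refine Finset.sum_congr rfl fun l hl => ?_
  rw [shuffleLaw_eq, PMF.uniformOfFinset_apply_of_mem _ hl]
  simp only [ENNReal.toReal_inv, ENNReal.toReal_natCast]
  ring

/-! ### Expectations, costs and invariants of oracle algorithms -/

namespace OracleAlg

variable {α : Type u} {β : Type v} {γ : Type w} [DecidableEq α]

/-- The expectation of `φ` at the output of a run with oracle `f`. -/
noncomputable def mean (f : Finset α → ℝ) : OracleAlg α β → (β → ℝ) → ℝ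
  | ret b, φ => φ b
  | query Q k, φ => mean f (k fun X => if X ∈ Q then f X else 0) φ
  | coin p k, φ => p * mean f (k true) φ + (1 - p) * mean f (k false) φ
  | shuffle X k, φ => (∑ l ∈ orderings X, mean f (k l) φ) / (orderings X).card

/-- The expected total cost of a run with oracle `f` if the batch `Q` costs `c Q`. -/
noncomputable def meanCost (c : Finset (Finset α) → ℝ) (f : Finset α → ℝ) : OracleAlg α β → ℝ
  | ret _ => 0
  | query Q k => c Q + meanCost c f (k fun X => if X ∈ Q then f X else 0)
  | coin p k => p * meanCost c f (k true) + (1 - p) * meanCost c f (k false)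
  | shuffle X k => (∑ l ∈ orderings X, meanCost c f (k l)) / (orderings X).card

/-- Every run with oracle `f` returns an output that satisfies `P`, and none of its batches has
more than `m` queries. -/
def Always (f : Finset α → ℝ) (m : ℕ) : OracleAlg α β → (β → Prop) → Prop
  | ret b, P => P b
  | query Q k, P => Q.card ≤ m ∧ Always f m (k fun X => if X ∈ Q then f X else 0) P
  | coin _ k, P => ∀ b, Always f m (k b) P
  | shuffle X k, P => ∀ l ∈ orderings X, Always f m (k l) P

variable {f : Finset α → ℝ} {m : ℕ} {c : Finset (Finset α) → ℝ}

lemma mean_bind (a : OracleAlg α β) (h : β → OracleAlg α γ) (φ : γ → ℝ) :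
    mean f (a.bind h) φ = mean f a fun b => mean f (h b) φ := by
  induction a with
  | ret b => rfl
  | query Q k ih => simp only [bind, mean, ih]
  | coin p k ih => simp only [bind, mean, ih]
  | shuffle X k ih => simp only [bind, mean, ih]

lemma Always.mono {a : OracleAlg α β} {P P' : β → Prop} (ha : Always f m a P)
    (h : ∀ b, P b → P' b) : Always f m a P' := by
  induction a with
  | ret b => exact h _ ha
  | query Q k ih => exact ⟨ha.1, ih _ ha.2⟩
  | coin p k ih => exact fun b => ih _ (ha b)
  | shuffle X k ih => exact fun l hl => ih _ (ha l hl)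

lemma Always.bind {a : OracleAlg α β} {h : β → OracleAlg α γ} {P : β → Prop} {P' : γ → Prop}
    (ha : Always f m a P) (hh : ∀ b, P b → Always f m (h b) P') : Always f m (a.bind h) P' := by
  induction a with
  | ret b => exact hh _ ha
  | query Q k ih => exact ⟨ha.1, ih _ ha.2⟩
  | coin p k ih => exact fun b => ih _ (ha b)
  | shuffle X k ih => exact fun l hl => ih _ (ha l hl)

lemma mean_mono {a : OracleAlg α β} {P : β → Prop} {φ ψ : β → ℝ} (ha : Always f m a P)
    (h : ∀ b, P b → φ b ≤ ψ b) : mean f a φ ≤ mean f a ψ := by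
  induction a with
  | ret b => exact h _ ha
  | query Q k ih => exact ih _ ha.2
  | coin p k ih =>
    have h1 : (0 : ℝ) ≤ 1 - (p : ℝ) := sub_nonneg.mpr p.2.2
    exact add_le_add (mul_le_mul_of_nonneg_left (ih _ (ha _)) p.2.1)
      (mul_le_mul_of_nonneg_left (ih _ (ha _)) h1)
  | shuffle X k ih =>
    exact div_le_div_of_nonneg_right (Finset.sum_le_sum fun l hl => ih _ (ha l hl))
      (orderings_card_pos X).le

lemma mean_congr {a : OracleAlg α β} {P : β → Prop} {φ ψ : β → ℝ} (ha : Always f m a P)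
    (h : ∀ b, P b → φ b = ψ b) : mean f a φ = mean f a ψ :=
  le_antisymm (mean_mono ha fun b hb => (h b hb).le) (mean_mono ha fun b hb => (h b hb).ge)

lemma mean_add (a : OracleAlg α β) (φ ψ : β → ℝ) :
    mean f a (fun b => φ b + ψ b) = mean f a φ + mean f a ψ := by
  induction a with
  | ret b => rfl
  | query Q k ih => exact ih _
  | coin p k ih => simp only [mean, ih]; ring
  | shuffle X k ih => simp only [mean, ih, Finset.sum_add_distrib, add_div]

lemma mean_mul (a : OracleAlg α β) (s : ℝ) (φ : β → ℝ) :
    mean f a (fun b => s * φ b) = s * mean f a φ := by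
  induction a with
  | ret b => rfl
  | query Q k ih => exact ih _
  | coin p k ih => simp only [mean, ih]; ring
  | shuffle X k ih => simp only [mean, ih, ← Finset.mul_sum, mul_div_assoc]

lemma mean_const (a : OracleAlg α β) (s : ℝ) : mean f a (fun _ => s) = s := by
  induction a with
  | ret b => rfl
  | query Q k ih => exact ih _
  | coin p k ih => simp only [mean, ih]; ring
  | shuffle X k ih =>
    have := (orderings_card_pos X).ne'
    simp only [mean, ih, Finset.sum_const, nsmul_eq_mul]
    field_simp

lemma mean_sub (a : OracleAlg α β) (φ ψ : β → ℝ) :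
    mean f a (fun b => φ b - ψ b) = mean f a φ - mean f a ψ := by
  have h := mean_add (f := f) a φ fun b => (-1) * ψ b
  rw [mean_mul] at h
  simp only [neg_one_mul, ← sub_eq_add_neg] at h
  exact h

lemma meanCost_bind (a : OracleAlg α β) (h : β → OracleAlg α γ) :
    meanCost c f (a.bind h) = meanCost c f a + mean f a fun b => meanCost c f (h b) := by
  induction a with
  | ret b => simp [bind, mean, meanCost]
  | query Q k ih => simp only [bind, mean, meanCost, ih]; ring
  | coin p k ih => simp only [bind, mean, meanCost, ih]; ring
  | shuffle X k ih => simp only [bind, mean, meanCost, ih, Finset.sum_add_distrib, add_div]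

lemma mean_mono_of_le {a : OracleAlg α β} {φ ψ : β → ℝ} (h : ∀ b, φ b ≤ ψ b) :
    mean f a φ ≤ mean f a ψ := by
  induction a with
  | ret b => exact h _
  | query Q k ih => exact ih _
  | coin p k ih =>
    have h1 : (0 : ℝ) ≤ 1 - (p : ℝ) := sub_nonneg.mpr p.2.2
    exact add_le_add (mul_le_mul_of_nonneg_left (ih _) p.2.1)
      (mul_le_mul_of_nonneg_left (ih _) h1)
  | shuffle X k ih =>
    exact div_le_div_of_nonneg_right (Finset.sum_le_sum fun l hl => ih _)
      (orderings_card_pos X).le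

lemma law_support_finite (a : OracleAlg α β) : (law f a).support.Finite := by
  induction a with
  | ret b => simp [law]
  | query Q k ih =>
    rw [law, PMF.support_map]
    exact (ih _).image _
  | coin p k ih =>
    rw [law, PMF.support_bind]
    exact (Set.toFinite _).biUnion fun b _ => ih b
  | shuffle X k ih =>
    rw [law, PMF.support_bind]
    refine Set.Finite.biUnion ?_ fun b _ => ih b
    rw [support_shuffleLaw]
    exact Finset.finite_toSet _

/-- The weights `s` and `t` let one induction serve the output, the rounds and the queries. The
largest batch is not additive along a run and is left to `Always`. -/
lemma expect_law (a : OracleAlg α β) (φ : β → ℝ) (s t : ℝ) :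
    expect (law f a) (fun x => φ x.1 + (s * x.2.rounds + t * x.2.queries)) =
      mean f a φ + meanCost (fun Q => s + t * Q.card) f a := by
  induction a with
  | ret b => simp [law, expect_pure, mean, meanCost]
  | query Q k ih =>
    rw [law, expect_map (law_support_finite _), mean, meanCost]
    have := ih (fun X => if X ∈ Q then f X else 0)
    rw [← add_assoc, add_right_comm, ← this]
    -- The cost of the current batch is a constant; it leaves the expectation because a law has
    -- total mass 1.
    have h2 : ∀ ν : PMF (β × Cost), ν.support.Finite → ∀ ψ : β × Cost → ℝ, ∀ r : ℝ,
        expect ν (fun x => ψ x + r) = expect ν ψ + r := by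
      intro ν hν ψ r
      have hone : expect ν (fun _ => (1 : ℝ)) = 1 := by
        unfold expect
        simp only [mul_one]
        rw [← ENNReal.tsum_toReal_eq fun x => PMF.apply_ne_top _ _, PMF.tsum_coe]
        simp
      rw [expect_eq_sum (s := hν.toFinset) (by simp)] at hone ⊢
      rw [expect_eq_sum (s := hν.toFinset) (by simp)]
      simp only [mul_add, Finset.sum_add_distrib]
      simp only [mul_one] at hone
      rw [← Finset.sum_mul, hone, one_mul]
    rw [← h2 _ (law_support_finite _)]
    congr 1
    funext x
    push_cast
    ring
  | coin p k ih =>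
    rw [law, expect_bind (Set.toFinite _) fun b _ => law_support_finite _, expect_coinLaw, ih, ih,
      mean, meanCost]
    ring
  | shuffle X k ih =>
    rw [law, expect_bind _ fun b _ => law_support_finite _, expect_shuffleLaw, mean, meanCost]
    · simp only [ih, Finset.sum_add_distrib, add_div]
    · rw [support_shuffleLaw]
      exact Finset.finite_toSet _

lemma meanCost_zero (a : OracleAlg α β) : meanCost (fun _ => 0) f a = 0 := by
  induction a with
  | ret b => rfl
  | query Q k ih => simp [meanCost, ih]
  | coin p k ih => simp [meanCost, ih]
  | shuffle X k ih => simp [meanCost, ih]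

lemma expect_law_output (a : OracleAlg α β) (φ : β → ℝ) :
    expect (law f a) (fun x => φ x.1) = mean f a φ := by
  simpa [meanCost_zero] using expect_law (f := f) a φ 0 0

lemma expect_law_cost (a : OracleAlg α β) (s t : ℝ) :
    expect (law f a) (fun x => s * x.2.rounds + t * x.2.queries) =
      meanCost (fun Q => s + t * Q.card) f a := by
  simpa [mean_const] using expect_law (f := f) a (fun _ => 0) s t

lemma Always.of_mem_support {a : OracleAlg α β} {P : β → Prop} (ha : Always f m a P)
    {x : β × Cost} (hx : x ∈ (law f a).support) : P x.1 ∧ x.2.maxBatch ≤ m := by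
  induction a generalizing x with
  | ret b =>
    simp only [law, PMF.support_pure, Set.mem_singleton_iff] at hx
    subst hx
    exact ⟨ha, Nat.zero_le _⟩
  | query Q k ih =>
    rw [law, PMF.support_map] at hx
    obtain ⟨y, hy, rfl⟩ := hx
    have := ih _ ha.2 hy
    exact ⟨this.1, max_le this.2 ha.1⟩
  | coin p k ih =>
    rw [law, PMF.mem_support_bind_iff] at hx
    obtain ⟨b, -, hb⟩ := hx
    exact ih _ (ha b) hb
  | shuffle X k ih =>
    rw [law, PMF.mem_support_bind_iff] at hx
    obtain ⟨l, hl, hb⟩ := hx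
    rw [support_shuffleLaw] at hl
    exact ih _ (ha l hl) hb

end OracleAlg

/-! ### Submodular functions -/

section Submodular

variable {α : Type u} [DecidableEq α] {f : Finset α → ℝ}

lemma gain_of_mem {X : Finset α} {u : α} (hu : u ∈ X) : gain f X u = 0 := by
  simp [gain, Finset.insert_eq_of_mem hu]

/-- The condition `u ∉ Y` cannot be dropped without monotonicity: for `u ∈ Y` the left side is 0 and
the right side may be negative. -/
lemma IsSubmodular.gain_le (hf : IsSubmodular f) {X Y : Finset α} (hXY : X ⊆ Y) {u : α}
    (hu : u ∉ Y) : gain f Y u ≤ gain f X u := by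
  have h := hf (insert u X) Y
  have h1 : insert u X ∪ Y = insert u Y := by
    rw [Finset.insert_union, Finset.union_eq_right.mpr hXY]
  have h2 : insert u X ∩ Y = X := by
    rw [Finset.insert_inter_of_notMem hu, Finset.inter_eq_left.mpr hXY]
  rw [h1, h2] at h
  unfold gain
  linarith

lemma IsSubmodular.union_le (hf : IsSubmodular f) (X Y : Finset α) :
    f (X ∪ Y) ≤ f X + ∑ u ∈ Y, gain f X u := by
  induction Y using Finset.induction_on with
  | empty => simp
  | insert a Y ha ih =>
    rw [Finset.sum_insert ha, Finset.union_insert]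
    have h1 : gain f (X ∪ Y) a ≤ gain f X a := by
      by_cases haX : a ∈ X
      · rw [gain_of_mem haX, gain_of_mem (Finset.mem_union_left _ haX)]
      · exact hf.gain_le Finset.subset_union_left (by simp [haX, ha])
    unfold gain at h1 ih ⊢
    linarith

lemma IsSubmodular.union_left (hf : IsSubmodular f) (O : Finset α) :
    IsSubmodular fun X => f (O ∪ X) := by
  intro X Y
  have h := hf (O ∪ X) (O ∪ Y)
  rwa [← Finset.union_union_distrib_left, ← Finset.union_inter_distrib_left] at h

end Submodular

/-! ### Submodular functions of random sets -/

section Sampling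

open OracleAlg

variable {α : Type u} [DecidableEq α] {β : Type v} {f h : Finset α → ℝ}

/-- Remove from `S` the element `u` that is least likely to be in `R`, with probability `q`. By
submodularity, restoring `u` changes the mean by at least `q (h S - h (S \ u))`. The induction
hypothesis with `m = q` supplies `q h (S \ u)`, which cancels. The free parameter `m` is what makes
this induction possible. -/
lemma le_mean_inter_of_prob_le (hh : IsSubmodular h) (h0 : ∀ X, 0 ≤ h X)
    (a : OracleAlg α β) (R : β → Finset α)
    {p : ℝ} (S : Finset α) :
    (∀ u ∈ S, mean f a (fun b => if u ∈ R b then 1 else 0) ≤ p) →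
    ∀ m : ℝ, m ≤ p → (∀ u ∈ S, m ≤ mean f a (fun b => if u ∈ R b then 1 else 0)) →
      (1 - p) * h ∅ + m * h S ≤ mean f a fun b => h (R b ∩ S) := by
  induction hn : S.card generalizing S with
  | zero =>
    intro _ m hm _
    rw [Finset.card_eq_zero] at hn
    subst hn
    simp only [Finset.inter_empty, mean_const]
    nlinarith [h0 ∅]
  | succ n ih =>
    intro hp m hm hmS
    have hne : S.Nonempty := by rw [← Finset.card_pos]; omega
    obtain ⟨u, huS, hu⟩ := Finset.exists_min_image S
      (fun u => mean f a (fun b => if u ∈ R b then (1 : ℝ) else 0)) hne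
    set q := mean f a (fun b => if u ∈ R b then (1 : ℝ) else 0) with hq
    have hS' : (S.erase u).card = n := by rw [Finset.card_erase_of_mem huS]; omega
    have h1 := ih (S.erase u) hS' (fun v hv => hp v (Finset.mem_of_mem_erase hv)) q (hp u huS)
      (fun v hv => hu v (Finset.mem_of_mem_erase hv))
    have h2 : mean f a (fun b => h (R b ∩ S.erase u) +
        (h S - h (S.erase u)) * (if u ∈ R b then 1 else 0)) ≤ mean f a fun b => h (R b ∩ S) := by
      refine mean_mono_of_le fun b => ?_
      by_cases hb : u ∈ R b
      · have e1 : R b ∩ S = insert u (R b ∩ S.erase u) := by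
          ext x
          simp only [Finset.mem_inter, Finset.mem_insert, Finset.mem_erase]
          by_cases hx : x = u
          · simp [hx, hb, huS]
          · simp [hx]
        have e2 := hh.gain_le (X := R b ∩ S.erase u) (Y := S.erase u) Finset.inter_subset_right
          (Finset.notMem_erase u S)
        unfold gain at e2
        rw [Finset.insert_erase huS, ← e1] at e2
        simp only [hb, if_true]
        linarith
      · have e1 : R b ∩ S = R b ∩ S.erase u := by
          ext x
          simp only [Finset.mem_inter, Finset.mem_erase]
          by_cases hx : x = u
          · simp [hx, hb]
          · simp [hx]
        simp [hb, e1]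
    rw [mean_add, mean_mul, ← hq] at h2
    have h3 := hmS u huS
    rw [← hq] at h3
    nlinarith [h0 S]

lemma le_mean_of_prob_le [Fintype α] (hh : IsSubmodular h) (h0 : ∀ X, 0 ≤ h X)
    (a : OracleAlg α β) (R : β → Finset α) {p : ℝ} (hp0 : 0 ≤ p)
    (hp : ∀ u, mean f a (fun b => if u ∈ R b then 1 else 0) ≤ p) :
    (1 - p) * h ∅ ≤ mean f a fun b => h (R b) := by
  have := le_mean_inter_of_prob_le (f := f) hh h0 a R univ (fun u _ => hp u) 0 hp0 fun u _ => by
    refine (mean_const (f := f) a 0).symm.le.trans (mean_mono_of_le fun b => ?_)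
    split_ifs <;> norm_num
  simpa using this

end Sampling

/-! ### Sums over orderings -/

section Orderings

variable {α : Type u} [DecidableEq α]

lemma card_orderings (X : Finset α) : (orderings X).card = X.card.factorial := by
  rw [orderings, List.toFinset_card_of_nodup (List.nodup_permutations _ X.nodup_toList),
    List.length_permutations, Finset.length_toList]

lemma orderings_eq_biUnion {X : Finset α} (hX : X.Nonempty) :
    orderings X = X.biUnion fun v => (orderings (X.erase v)).image (List.cons v) := by
  ext l
  simp only [Finset.mem_biUnion, Finset.mem_image, mem_orderings]
  constructor
  · rintro ⟨hl, rfl⟩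
    cases l with
    | nil => simp at hX
    | cons v l =>
      rw [List.nodup_cons] at hl
      refine ⟨v, by simp, l, ⟨hl.2, ?_⟩, rfl⟩
      rw [List.toFinset_cons, Finset.erase_insert]
      simpa using hl.1
  · rintro ⟨v, hv, l, ⟨hl, hl'⟩, rfl⟩
    refine ⟨List.nodup_cons.mpr ⟨fun h => ?_, hl⟩, ?_⟩
    · have : v ∈ X.erase v := hl' ▸ List.mem_toFinset.mpr h
      simp at this
    · rw [List.toFinset_cons, hl', Finset.insert_erase hv]

lemma sum_orderings {X : Finset α} (hX : X.Nonempty) (F : List α → ℝ) :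
    ∑ l ∈ orderings X, F l = ∑ v ∈ X, ∑ l ∈ orderings (X.erase v), F (v :: l) := by
  rw [orderings_eq_biUnion hX, Finset.sum_biUnion]
  · refine Finset.sum_congr rfl fun v _ => ?_
    rw [Finset.sum_image fun a _ b _ h => (List.cons_injective h)]
  · intro a _ b _ hab
    rw [Function.onFun, Finset.disjoint_left]
    intro l hl hl'
    rw [Finset.mem_image] at hl hl'
    obtain ⟨_, _, rfl⟩ := hl
    obtain ⟨_, _, h⟩ := hl'
    exact hab (List.cons.inj h).1.symm

/-- If the sum of `H P v` over the elements `v` that are not in `P` is nonnegative for each initial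
segment `P`, then the expectation of `H P v` is nonnegative, where `v` is the `i`-th element of a
uniformly random ordering and `P` is the segment before it. -/
lemma sum_orderings_getElem_nonneg (X : Finset α) (H : List α → α → ℝ) (i : ℕ)
    (hH : ∀ P : List α, P.Nodup → P.toFinset ⊆ X → 0 ≤ ∑ v ∈ X \ P.toFinset, H P v) :
    0 ≤ ∑ l ∈ orderings X, l[i]?.elim 0 (H (l.take i)) := by
  induction i generalizing X H with
  | zero =>
    rcases X.eq_empty_or_nonempty with rfl | hX
    · refine Finset.sum_nonneg fun l hl => ?_
      have := (mem_orderings.mp hl).2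
      rw [List.toFinset_eq_empty_iff] at this
      simp [this]
    · rw [sum_orderings hX]
      have h0 := hH [] List.nodup_nil (by simp)
      simp only [List.toFinset_nil, Finset.sdiff_empty] at h0
      have : ∀ v ∈ X, ∑ l ∈ orderings (X.erase v), (v :: l)[0]?.elim 0 (H ((v :: l).take 0)) =
          ((X.card - 1).factorial : ℝ) * H [] v := by
        intro v hv
        simp [card_orderings, Finset.card_erase_of_mem hv]
      rw [Finset.sum_congr rfl this, ← Finset.mul_sum]
      positivity
  | succ i ih =>
    rcases X.eq_empty_or_nonempty with rfl | hX
    · refine Finset.sum_nonneg fun l hl => ?_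
      have := (mem_orderings.mp hl).2
      rw [List.toFinset_eq_empty_iff] at this
      simp [this]
    · rw [sum_orderings hX]
      -- Condition on the first element `v`: the rest is a uniform ordering of `X.erase v`, and `H
      -- (v :: ·)` inherits the hypothesis.
      refine Finset.sum_nonneg fun v hv => ?_
      simp only [List.getElem?_cons_succ, List.take_succ_cons]
      refine ih (X.erase v) (fun P => H (v :: P)) fun P hP hPX => ?_
      have hvP : v ∉ P := fun h => by
        have := hPX (List.mem_toFinset.mpr h)
        simp at this
      have h1 := hH (v :: P) (List.nodup_cons.mpr ⟨hvP, hP⟩) (by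
        rw [List.toFinset_cons]
        exact Finset.insert_subset hv (hPX.trans (Finset.erase_subset _ _)))
      have h2 : X.erase v \ P.toFinset = X \ (v :: P).toFinset := by
        ext x
        simp only [Finset.mem_sdiff, Finset.mem_erase, List.toFinset_cons, Finset.mem_insert]
        tauto
      rw [h2]
      exact h1

end Orderings

open OracleAlg

/-! ### Search for the first index -/

lemma firstIndex_mem (d : ℕ) (P : ℕ → Prop) :
    1 ≤ firstIndex d P ∧ (P (firstIndex d P) ∨ d < firstIndex d P) :=
  Nat.sInf_mem (s := {i | 1 ≤ i ∧ (P i ∨ d < i)}) ⟨d + 1, by simp⟩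

lemma firstIndex_le (d : ℕ) (P : ℕ → Prop) : firstIndex d P ≤ d + 1 :=
  Nat.sInf_le (by simp)

lemma not_of_lt_firstIndex {d : ℕ} {P : ℕ → Prop} {i : ℕ} (h1 : 1 ≤ i)
    (hi : i < firstIndex d P) : ¬ P i := fun h => Nat.notMem_of_lt_sInf hi ⟨h1, Or.inl h⟩

/-- `t` is admissible as a result of the search for an index in `{1, …, d}` that satisfies `P`,
and the least such index if `P` is monotone. -/
def IndexSpec (d : ℕ) (P : ℕ → Prop) (t : ℕ) : Prop :=
  1 ≤ t ∧ t ≤ d + 1 ∧ (P t ∨ t = d + 1) ∧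
    ((∀ i j, 1 ≤ i → i ≤ j → j ≤ d → P i → P j) → t = firstIndex d P)

lemma indexSpec_firstIndex {d : ℕ} {P Q : ℕ → Prop} (h : ∀ i ≤ d, (P i ↔ Q i)) :
    IndexSpec d Q (firstIndex d P) := by
  have h0 : firstIndex d P = firstIndex d Q := by
    unfold firstIndex
    congr 1
    ext i
    simp only [Set.mem_ofPred_eq]
    rcases le_or_gt i d with hi | hi
    · rw [h i hi]
    · simp [hi]
  rw [h0]
  have h1 := firstIndex_mem d Q
  have h2 := firstIndex_le d Q
  refine ⟨h1.1, h2, h1.2.imp_right fun h => by omega, fun _ => rfl⟩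

section BinarySearch

lemma bsearch_eq {α : Type u} (test : ℕ → OracleAlg α Bool) (lo hi : ℕ) :
    bsearch test lo hi = if lo < hi then
      (test ((lo + hi) / 2)).bind fun b =>
        if b then bsearch test lo ((lo + hi) / 2) else bsearch test ((lo + hi) / 2 + 1) hi
      else .ret lo := by
  rw [bsearch]
  simp

variable {α : Type u} [DecidableEq α] {f : Finset α → ℝ} {m : ℕ}
  {c : Finset (Finset α) → ℝ}

/-- Monotonicity is not assumed: the search only maintains that its upper end is untested or passes
and that the index before its lower end, if tested, fails. For a monotone test this pins down the
least index. -/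
lemma always_bsearch (test : ℕ → OracleAlg α Bool) (P : ℕ → Prop) (lo hi : ℕ) (hlh : lo ≤ hi)
    (ht : ∀ i, lo ≤ i → i < hi → Always f m (test i) fun b => (b = true ↔ P i)) :
    Always f m (bsearch test lo hi) fun t =>
      lo ≤ t ∧ t ≤ hi ∧ (P t ∨ t = hi) ∧ (t = lo ∨ ¬ P (t - 1)) := by
  induction hn : hi - lo using Nat.strong_induction_on generalizing lo hi with
  | _ n ih =>
    rw [bsearch_eq]
    split_ifs with h
    · refine (ht ((lo + hi) / 2) (by omega) (by omega)).bind fun b hb => ?_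
      cases b with
      | true =>
        simp only [true_iff] at hb
        simp only [if_true]
        refine (ih _ (by omega) lo _ (by omega) (fun i h1 h2 => ht i h1 (by omega)) rfl).mono ?_
        rintro t ⟨h1, h2, h3, h4⟩
        refine ⟨h1, by omega, ?_, h4⟩
        rcases h3 with h3 | rfl
        · exact Or.inl h3
        · exact Or.inl hb
      | false =>
        simp only [Bool.false_eq_true, false_iff] at hb
        simp only [Bool.false_eq_true, if_false]
        refine (ih _ (by omega) _ hi (by omega) (fun i h1 h2 => ht i (by omega) h2) rfl).mono ?_
        rintro t ⟨h1, h2, h3, h4⟩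
        refine ⟨by omega, h2, h3, Or.inr ?_⟩
        rcases h4 with rfl | h4
        · simpa using hb
        · exact h4
    · exact ⟨le_rfl, hlh, Or.inr (by omega), Or.inl rfl⟩

lemma always_bsearch_indexSpec (test : ℕ → OracleAlg α Bool) (P : ℕ → Prop) (d : ℕ)
    (ht : ∀ i, 1 ≤ i → i ≤ d → Always f m (test i) fun b => (b = true ↔ P i)) :
    Always f m (bsearch test 1 (d + 1)) (IndexSpec d P) := by
  refine (always_bsearch test P 1 (d + 1) (by omega) fun i h1 h2 => ht i h1 (by omega)).mono ?_
  rintro t ⟨h1, h2, h3, h4⟩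
  refine ⟨h1, h2, h3, fun hmono => ?_⟩
  have g1 := firstIndex_mem d P
  have g2 := firstIndex_le d P
  refine le_antisymm ?_ ?_
  · by_contra hlt
    push Not at hlt
    rcases h4 with rfl | h4
    · omega
    · rcases g1.2 with h | h
      · exact h4 (hmono _ _ g1.1 (by omega) (by omega) h)
      · omega
  · by_contra hlt
    push Not at hlt
    rcases h3 with h3 | rfl
    · exact not_of_lt_firstIndex h1 hlt h3
    · omega

lemma meanCost_bsearch_le (test : ℕ → OracleAlg α Bool) {κ : ℝ} (hκ : 0 ≤ κ) (k lo hi : ℕ)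
    (hk : hi - lo < 2 ^ k) (ht : ∀ i, lo ≤ i → i < hi → meanCost c f (test i) ≤ κ) :
    meanCost c f (bsearch test lo hi) ≤ k * κ := by
  induction k generalizing lo hi with
  | zero =>
    rw [bsearch_eq, if_neg (by simp at hk; omega)]
    simp [meanCost]
  | succ k ih =>
    rw [bsearch_eq]
    rw [pow_succ] at hk
    split_ifs with h
    · rw [meanCost_bind]
      have h1 := ht ((lo + hi) / 2) (by omega) (by omega)
      have h2 : mean f (test ((lo + hi) / 2)) (fun b => meanCost c f
          (if b = true then bsearch test lo ((lo + hi) / 2)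
            else bsearch test ((lo + hi) / 2 + 1) hi)) ≤ k * κ := by
        rw [← mean_const (f := f) (test ((lo + hi) / 2)) (k * κ)]
        refine mean_mono_of_le fun b => ?_
        split_ifs
        · exact ih _ _ (by omega) fun i h1 h2 => ht i h1 (by omega)
        · exact ih _ _ (by omega) fun i h1 h2 => ht i (by omega) h2
      push_cast
      linarith
    · simp only [meanCost]
      positivity

end BinarySearch

/-! ### The stopping conditions: queries needed, monotonicity in the index, cost of the search. -/

section Indices

variable {α : Type u} [DecidableEq α] {f g : Finset α → ℝ} {𝓘 : Finset (Finset α)} {ρ ε : ℝ}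
  {X L : Finset α} {V : List α} {m r : ℕ} {c : Finset (Finset α) → ℝ}

lemma prefixSet_mem_probeSets {i j : ℕ} (hij : j ≤ i) : prefixSet X V j ∈ probeSets X V L i :=
  Finset.mem_union_left _ (Finset.mem_image_of_mem _ (by simp; omega))

lemma insert_mem_probeSets {i : ℕ} {u : α} (hu : u ∈ L) :
    insert u (prefixSet X V i) ∈ probeSets X V L i :=
  Finset.mem_union_right _ (Finset.mem_image_of_mem (fun u => insert u (prefixSet X V i)) hu)

lemma card_probeSets_le (i : ℕ) : (probeSets X V L i).card ≤ i + 1 + L.card := by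
  refine (Finset.card_union_le _ _).trans ?_
  refine add_le_add (Finset.card_image_le.trans ?_) Finset.card_image_le
  simp

/-- The prefixes are shared between the indices and counted once; adding up `card_probeSets_le`
would give a term quadratic in `d`. -/
lemma card_biUnion_probeSets_le (d : ℕ) :
    ((range (d + 1)).biUnion (probeSets X V L)).card ≤ (d + 1) * (L.card + 1) := by
  have h : (range (d + 1)).biUnion (probeSets X V L) ⊆
      (range (d + 1)).image (prefixSet X V) ∪
        (range (d + 1)).biUnion fun i => L.image fun u => insert u (prefixSet X V i) := by
    intro Y hY
    simp only [probeSets, Finset.mem_biUnion, Finset.mem_union, Finset.mem_image,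
      Finset.mem_range] at hY ⊢
    obtain ⟨i, hi, ⟨j, hj, rfl⟩ | hY⟩ := hY
    · exact Or.inl ⟨j, by omega, rfl⟩
    · exact Or.inr ⟨i, hi, hY⟩
  refine (Finset.card_le_card h).trans ((Finset.card_union_le _ _).trans ?_)
  have h1 : ((range (d + 1)).image (prefixSet X V)).card ≤ d + 1 :=
    Finset.card_image_le.trans (by simp)
  have h2 : ((range (d + 1)).biUnion fun i => L.image fun u => insert u (prefixSet X V i)).card ≤
      (range (d + 1)).card * L.card :=
    Finset.card_biUnion_le_card_mul _ _ _ fun i _ => Finset.card_image_le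
  rw [Finset.card_range] at h2
  rw [mul_add, mul_one]
  omega

lemma gain_congr {Y : Finset α} {u : α} (h1 : g Y = f Y) (h2 : g (insert u Y) = f (insert u Y)) :
    gain g Y u = gain f Y u := by simp [gain, h1, h2]

lemma valuable_congr {Y : Finset α} (h : ∀ u ∈ L, gain g Y u = gain f Y u) :
    valuable 𝓘 ρ g Y L = valuable 𝓘 ρ f Y L :=
  Finset.filter_congr fun u hu => by rw [h u hu]

lemma gain_eq_of_probeSets {i : ℕ} (h : ∀ Y ∈ probeSets X V L i, g Y = f Y) :
    ∀ u ∈ L, gain g (prefixSet X V i) u = gain f (prefixSet X V i) u := fun _ hu =>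
  gain_congr (h _ (prefixSet_mem_probeSets le_rfl)) (h _ (insert_mem_probeSets hu))

lemma costCond_congr {i : ℕ} (h : ∀ Y ∈ probeSets X V L i, g Y = f Y) :
    costCond 𝓘 ρ ε g X V L i ↔ costCond 𝓘 ρ ε f X V L i := by
  unfold costCond
  rw [valuable_congr (gain_eq_of_probeSets h)]

/-- Positive parts replace a filter that depends on `f` by a fixed range, so that values at
different indices can be compared termwise. -/
lemma dropSum_eq (f : Finset α → ℝ) (X : Finset α) (V : List α) (i : ℕ) :
    dropSum f X V i = ∑ j ∈ range i, max (f (prefixSet X V j) - f (prefixSet X V (j + 1))) 0 := by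
  unfold dropSum
  rw [Finset.sum_filter]
  refine Finset.sum_congr rfl fun j _ => ?_
  split_ifs with h
  · rw [abs_of_neg h, max_eq_left (by linarith)]; ring
  · rw [max_eq_right (by linarith)]

lemma sum_negative_eq (f : Finset α → ℝ) (X L : Finset α) :
    ∑ u ∈ negative f X L, |gain f X u| = ∑ u ∈ L, max (-gain f X u) 0 := by
  unfold negative
  rw [Finset.sum_filter]
  refine Finset.sum_congr rfl fun j _ => ?_
  split_ifs with h
  · rw [abs_of_neg h, max_eq_left (by linarith)]
  · rw [max_eq_right (by linarith)]

lemma valueCond_congr {i : ℕ} (h : ∀ Y ∈ probeSets X V L i, g Y = f Y) :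
    valueCond 𝓘 ρ ε g X V L i ↔ valueCond 𝓘 ρ ε f X V L i := by
  have h0 := gain_eq_of_probeSets h
  have h1 : ∑ u ∈ valuable 𝓘 ρ f (prefixSet X V i) L, gain g (prefixSet X V i) u =
      ∑ u ∈ valuable 𝓘 ρ f (prefixSet X V i) L, gain f (prefixSet X V i) u :=
    Finset.sum_congr rfl fun u hu => h0 u (Finset.mem_of_mem_filter u hu)
  have h2 : ∑ u ∈ L, max (-gain g (prefixSet X V i) u) 0 =
      ∑ u ∈ L, max (-gain f (prefixSet X V i) u) 0 :=
    Finset.sum_congr rfl fun u hu => by rw [h0 u hu]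
  have h3 : dropSum g X V i = dropSum f X V i := by
    rw [dropSum_eq, dropSum_eq]
    refine Finset.sum_congr rfl fun j hj => ?_
    rw [Finset.mem_range] at hj
    rw [h _ (prefixSet_mem_probeSets hj.le), h _ (prefixSet_mem_probeSets hj)]
  unfold valueCond
  rw [valuable_congr h0, sum_negative_eq, sum_negative_eq, h1, h2, h3]

/-- Neither submodularity nor `0 < ρ` enters, so feasibility and costs are also covered when all
thresholds are 0. -/
lemma always_findIndices (mode : SearchMode) (hm : (V.length + 1) * (L.card + 1) ≤ m) :
    Always f m (findIndices mode 𝓘 ρ ε X V L) fun t =>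
      IndexSpec V.length (costCond 𝓘 ρ ε f X V L) t.1 ∧
      IndexSpec V.length (valueCond 𝓘 ρ ε f X V L) t.2 := by
  cases mode with
  | exhaustive =>
    have h : ∀ i ≤ V.length, ∀ Y ∈ probeSets X V L i,
        (if Y ∈ (range (V.length + 1)).biUnion (probeSets X V L) then f Y else 0) = f Y := by
      intro i hi Y hY
      rw [if_pos]
      exact Finset.mem_biUnion.mpr ⟨i, by simp; omega, hY⟩
    exact ⟨(card_biUnion_probeSets_le _).trans hm,
      indexSpec_firstIndex fun i hi => costCond_congr (h i hi),
      indexSpec_firstIndex fun i hi => valueCond_congr (h i hi)⟩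
  | binary =>
    have hc : ∀ i, 1 ≤ i → i ≤ V.length → (probeSets X V L i).card ≤ m := by
      intro i _ hi
      refine (card_probeSets_le i).trans (le_trans ?_ hm)
      nlinarith
    refine (always_bsearch_indexSpec _ _ _ fun i h1 h2 => ?_).bind fun t₁ ht₁ =>
      (always_bsearch_indexSpec _ _ _ fun i h1 h2 => ?_).bind fun t₂ ht₂ => ⟨ht₁, ht₂⟩
    · refine ⟨hc i h1 h2, ?_⟩
      simp only [Always, decide_eq_true_iff]
      exact costCond_congr fun Y hY => if_pos hY
    · refine ⟨hc i h1 h2, ?_⟩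
      simp only [Always, decide_eq_true_iff]
      exact valueCond_congr fun Y hY => if_pos hY

lemma meanCost_findIndices_exhaustive :
    meanCost c f (findIndices .exhaustive 𝓘 ρ ε X V L) =
      c ((range (V.length + 1)).biUnion (probeSets X V L)) := by
  simp [findIndices, meanCost]

lemma meanCost_findIndices_binary_le {κ : ℝ} (hκ : 0 ≤ κ)
    (hc : ∀ i ≤ V.length, c (probeSets X V L i) ≤ κ) :
    meanCost c f (findIndices .binary 𝓘 ρ ε X V L) ≤ 2 * (Nat.log 2 V.length + 1) * κ := by
  have h1 : V.length + 1 - 1 < 2 ^ (Nat.log 2 V.length + 1) := by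
    simpa using Nat.lt_pow_succ_log_self (b := 2) (by norm_num) V.length
  have h2 : ∀ P : ℕ → (Finset α → ℝ) → Bool,
      meanCost c f (bsearch (fun i => .query (probeSets X V L i) fun g => .ret (P i g)) 1
        (V.length + 1)) ≤ (Nat.log 2 V.length + 1 : ℕ) * κ := fun P =>
    meanCost_bsearch_le _ hκ _ _ _ h1 fun i _ hi => by
      simpa [meanCost] using hc i (by omega)
  simp only [findIndices, meanCost_bind]
  have h3 : ∀ a : OracleAlg α ℕ, ∀ φ : ℕ → ℝ, (∀ t, φ t ≤ (Nat.log 2 V.length + 1 : ℕ) * κ) →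
      mean f a φ ≤ (Nat.log 2 V.length + 1 : ℕ) * κ := fun a φ hφ => by
    rw [← mean_const (f := f) a ((Nat.log 2 V.length + 1 : ℕ) * κ)]
    exact mean_mono_of_le hφ
  refine (add_le_add (h2 _) (h3 _ _ fun t => ?_)).trans_eq ?_
  · refine (add_le_add (h2 _) (le_of_eq ?_)).trans_eq (add_zero _)
    simp [meanCost, mean_const]
  · push_cast; ring

lemma prefixSet_mono (X : Finset α) (V : List α) : Monotone (prefixSet X V) := by
  intro i j hij
  refine Finset.union_subset_union_right fun x hx => ?_
  rw [List.mem_toFinset] at hx ⊢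
  exact List.take_subset_take_left V hij hx

lemma prefixSet_succ {i : ℕ} (hi : i < V.length) :
    prefixSet X V (i + 1) = insert V[i] (prefixSet X V i) := by
  unfold prefixSet
  rw [List.take_succ_eq_append_getElem hi, List.toFinset_append, ← Finset.union_assoc]
  ext x
  simp

/-- A positive threshold excludes `u ∈ Y`, where the gain is 0; then submodularity applies. -/
lemma mem_of_valuable_pos (hf : IsSubmodular f) (h𝓘 : ∀ Y, Y ∈ 𝓘 ↔ Y.card ≤ r) (hρ : 0 < ρ)
    {Y : Finset α} (hXY : X ⊆ Y) {u : α} (hu : u ∈ valuable 𝓘 ρ f Y L) :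
    u ∈ valuable 𝓘 ρ f X L ∧ gain f Y u ≤ gain f X u := by
  unfold valuable at hu ⊢
  rw [Finset.mem_filter] at hu ⊢
  obtain ⟨h1, h2, h3⟩ := hu
  have huY : u ∉ Y := fun h => by rw [gain_of_mem h] at h2; linarith
  have h4 := hf.gain_le hXY huY
  refine ⟨⟨h1, h2.trans h4, ?_⟩, h4⟩
  rw [h𝓘] at h3 ⊢
  exact (Finset.card_le_card (Finset.insert_subset_insert _ hXY)).trans h3

lemma costCond_mono (hf : IsSubmodular f) (h𝓘 : ∀ Y, Y ∈ 𝓘 ↔ Y.card ≤ r) (hρ : 0 < ρ)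
    {i j : ℕ} (hij : i ≤ j) (h : costCond 𝓘 ρ ε f X V L i) : costCond 𝓘 ρ ε f X V L j := by
  refine le_trans ?_ h
  exact_mod_cast Finset.card_le_card fun u hu =>
    (mem_of_valuable_pos hf h𝓘 hρ (prefixSet_mono X V hij) hu).1

/-- The left side of the condition decreases by submodularity. On the right, the only element whose
negative gain can disappear is the one just added, and exactly this loss reappears as the new term
of `dropSum`. -/
lemma valueCond_succ (hf : IsSubmodular f) (h𝓘 : ∀ Y, Y ∈ 𝓘 ↔ Y.card ≤ r) (hρ : 0 < ρ)
    (hε : 0 ≤ ε) {i : ℕ} (hi : i < V.length) (h : valueCond 𝓘 ρ ε f X V L i) :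
    valueCond 𝓘 ρ ε f X V L (i + 1) := by
  unfold valueCond at h ⊢
  rw [sum_negative_eq, dropSum_eq] at h ⊢
  rw [Finset.sum_range_succ]
  have hsub := prefixSet_mono X V (Nat.le_succ i)
  have h1 : ∑ u ∈ valuable 𝓘 ρ f (prefixSet X V (i + 1)) L, gain f (prefixSet X V (i + 1)) u ≤
      ∑ u ∈ valuable 𝓘 ρ f (prefixSet X V i) L, gain f (prefixSet X V i) u := by
    refine (Finset.sum_le_sum fun u hu => (mem_of_valuable_pos hf h𝓘 hρ hsub hu).2).trans ?_
    refine Finset.sum_le_sum_of_subset_of_nonneg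
      (fun u hu => (mem_of_valuable_pos hf h𝓘 hρ hsub hu).1) fun u hu _ => ?_
    exact hρ.le.trans (Finset.mem_filter.mp hu).2.1
  have h2 : ∑ u ∈ L, max (-gain f (prefixSet X V i) u) 0 ≤
      ∑ u ∈ L, max (-gain f (prefixSet X V (i + 1)) u) 0 +
        max (f (prefixSet X V i) - f (prefixSet X V (i + 1))) 0 := by
    -- The correction term is nonzero only for `V[i]`, whose gain becomes 0 on joining the prefix.
    have h3 : ∀ u ∈ L, max (-gain f (prefixSet X V i) u) 0 ≤
        max (-gain f (prefixSet X V (i + 1)) u) 0 +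
          if u = V[i] then max (f (prefixSet X V i) - f (prefixSet X V (i + 1))) 0 else 0 := by
      intro u _
      split_ifs with huv
      · have : -gain f (prefixSet X V i) u = f (prefixSet X V i) - f (prefixSet X V (i + 1)) := by
          rw [prefixSet_succ hi, huv, gain]; ring
        rw [this]
        exact le_add_of_nonneg_left (le_max_right _ _)
      · rw [add_zero]
        by_cases hu : u ∈ prefixSet X V i
        · rw [gain_of_mem hu]
          simp
        · refine max_le_max_right 0 (neg_le_neg (hf.gain_le hsub ?_))
          rw [prefixSet_succ hi, Finset.mem_insert]
          tauto
    refine (Finset.sum_le_sum h3).trans ?_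
    rw [Finset.sum_add_distrib, Finset.sum_ite_eq']
    refine add_le_add le_rfl ?_
    split_ifs
    · exact le_rfl
    · exact le_max_right _ _
  have h4 := mul_le_mul_of_nonneg_left h1 hε
  linarith

lemma valueCond_mono (hf : IsSubmodular f) (h𝓘 : ∀ Y, Y ∈ 𝓘 ↔ Y.card ≤ r) (hρ : 0 < ρ)
    (hε : 0 ≤ ε) {i j : ℕ} (hij : i ≤ j) (hj : j ≤ V.length)
    (h : valueCond 𝓘 ρ ε f X V L i) : valueCond 𝓘 ρ ε f X V L j := by
  induction j, hij using Nat.le_induction with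
  | base => exact h
  | succ j _ ih => exact valueCond_succ hf h𝓘 hρ hε (by omega) (ih (by omega))

lemma mean_findIndices (hf : IsSubmodular f) (h𝓘 : ∀ Y, Y ∈ 𝓘 ↔ Y.card ≤ r) (hρ : 0 < ρ)
    (hε : 0 ≤ ε) (mode : SearchMode) (φ : ℕ × ℕ → ℝ) :
    mean f (findIndices mode 𝓘 ρ ε X V L) φ =
      φ (firstIndex V.length (costCond 𝓘 ρ ε f X V L),
        firstIndex V.length (valueCond 𝓘 ρ ε f X V L)) := by
  rw [mean_congr (always_findIndices mode le_rfl) (fun t ht => ?_), mean_const]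
  rw [← ht.1.2.2.2 fun i j _ hij _ h => costCond_mono hf h𝓘 hρ hij h,
    ← ht.2.2.2.2 fun i j _ hij hj h => valueCond_mono hf h𝓘 hρ hε hij hj h]

end Indices

/-! ### Random sequences under a cardinality constraint. -/

section Sequence

variable {α : Type u} [DecidableEq α] {𝓘 : Finset (Finset α)} {X L : Finset α} {r : ℕ}

lemma getSeqLoop_empty (𝓘 : Finset (Finset α)) (X : Finset α) (m : ℕ) (V : List α) :
    getSeqLoop 𝓘 X m V ∅ = .ret V := by
  cases m <;> simp [getSeqLoop]

lemma card_union_take {l : List α} (hl : l ∈ orderings L) (hXL : Disjoint X L) {i : ℕ}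
    (hi : i ≤ L.card) : (X ∪ (l.take i).toFinset).card = X.card + i := by
  obtain ⟨h1, rfl⟩ := mem_orderings.mp hl
  rw [List.toFinset_card_of_nodup h1] at hi
  rw [Finset.card_union_of_disjoint, List.toFinset_card_of_nodup (h1.take), List.length_take,
    min_eq_left hi]
  refine hXL.mono_right fun x hx => ?_
  rw [List.mem_toFinset] at hx ⊢
  exact List.mem_of_mem_take hx

lemma length_of_mem_orderings {l : List α} (hl : l ∈ orderings L) : l.length = L.card := by
  obtain ⟨h1, rfl⟩ := mem_orderings.mp hl
  rw [List.toFinset_card_of_nodup h1]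

/-- The longest feasible prefix of an ordering cannot be extended. -/
lemma insert_notMem_of_notMem_take (h𝓘 : ∀ Y, Y ∈ 𝓘 ↔ Y.card ≤ r) (hX : X.card ≤ r)
    (hXL : Disjoint X L) {l : List α} (hl : l ∈ orderings L) {u : α} (hu : u ∈ L)
    (h1 : u ∉ l.take (r - X.card)) :
    insert u (X ∪ (l.take (r - X.card)).toFinset) ∉ 𝓘 := by
  intro h2
  have hlen := length_of_mem_orderings hl
  rcases le_total L.card (r - X.card) with h | h
  · rw [List.take_of_length_le (by omega)] at h1
    rw [← (mem_orderings.mp hl).2, List.mem_toFinset] at hu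
    exact h1 hu
  · rw [h𝓘, Finset.card_insert_of_notMem, card_union_take hl hXL h] at h2
    · omega
    · rw [Finset.mem_union, List.mem_toFinset]
      rintro (h3 | h3)
      · exact Finset.disjoint_left.mp hXL h3 hu
      · exact h1 h3

/-- The longest feasible prefix either exhausts `L` or fills the solution, so a single pass finishes
the sequence: it is an initial segment of one uniform ordering. -/
lemma getSeq_eq_shuffle (h𝓘 : ∀ Y, Y ∈ 𝓘 ↔ Y.card ≤ r) (hX : X.card ≤ r) (hXL : Disjoint X L)
    (hL : L ≠ ∅) :
    ∃ k, getSeq 𝓘 X L = .shuffle L k ∧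
      ∀ l ∈ orderings L, k l = .ret (l.take (r - X.card)) := by
  obtain ⟨m, hm⟩ : ∃ m, L.card = m + 1 :=
    Nat.exists_eq_succ_of_ne_zero (by rwa [Ne, Finset.card_eq_zero])
  rw [getSeq, hm, getSeqLoop, if_neg hL]
  refine ⟨_, rfl, fun l hl => ?_⟩
  have hlen := length_of_mem_orderings hl
  have hs : Nat.findGreatest (fun i => X ∪ ([] : List α).toFinset ∪ (l.take i).toFinset ∈ 𝓘)
      l.length = min l.length (r - X.card) := by
    rw [Nat.findGreatest_eq_iff]
    simp only [List.toFinset_nil, Finset.union_empty, h𝓘]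
    refine ⟨min_le_left _ _, fun _ => ?_, fun i h1 h2 => ?_⟩
    · rw [card_union_take hl hXL (by omega)]
      omega
    · rw [card_union_take hl hXL (by omega)]
      omega
  have htake : l.take (min l.length (r - X.card)) = l.take (r - X.card) := by
    rw [List.take_eq_take_iff]
    omega
  simp only [hs, List.nil_append, htake]
  have hemp : (L.filter fun u => u ∉ l.take (r - X.card) ∧
      insert u (X ∪ (l.take (r - X.card)).toFinset) ∈ 𝓘) = ∅ := by
    rw [Finset.filter_eq_empty_iff]
    rintro u hu ⟨h1, h2⟩
    exact insert_notMem_of_notMem_take h𝓘 hX hXL hl hu h1 h2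
  rw [hemp, getSeqLoop_empty]

end Sequence

/-! ### One iteration of `RandBatch` -/

section Step

variable {α : Type u} [DecidableEq α] {f : Finset α → ℝ} {𝓘 : Finset (Finset α)} {ρ ε : ℝ}
  {T A U L : Finset α} {m r M N count : ℕ} {c : Finset (Finset α) → ℝ} {mode : SearchMode}

/-- The elements of `V` up to the smaller of the two indices. -/
def batch (V : List α) (t : ℕ × ℕ) : Finset α := (V.take (min t.1 t.2)).toFinset

/-- The batch that is submitted by `queryValuable`. -/
def valuableSets (X L : Finset α) : Finset (Finset α) := insert X (L.image fun u => insert u X)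

lemma card_valuableSets_le (X L : Finset α) : (valuableSets X L).card ≤ L.card + 1 :=
  (Finset.card_insert_le _ _).trans (Nat.add_le_add_right Finset.card_image_le 1)

lemma valuable_answers (X L : Finset α) :
    valuable 𝓘 ρ (fun Y => if Y ∈ valuableSets X L then f Y else 0) X L = valuable 𝓘 ρ f X L :=
  valuable_congr fun _ hu => gain_congr (if_pos (Finset.mem_insert_self _ _))
    (if_pos (Finset.mem_insert_of_mem (Finset.mem_image_of_mem (fun u => insert u X) hu)))

lemma mean_queryValuable (X L : Finset α) (φ : Finset α → ℝ) :
    mean f (queryValuable 𝓘 ρ X L) φ = φ (valuable 𝓘 ρ f X L) :=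
  congrArg φ (valuable_answers X L)

lemma meanCost_queryValuable (X L : Finset α) :
    meanCost c f (queryValuable 𝓘 ρ X L) = c (valuableSets X L) := by
  simp [queryValuable, meanCost, valuableSets]

lemma always_queryValuable (X L : Finset α) (hm : L.card + 1 ≤ m) :
    Always f m (queryValuable 𝓘 ρ X L) fun L' => L' = valuable 𝓘 ρ f X L :=
  ⟨(card_valuableSets_le X L).trans hm, valuable_answers X L⟩

lemma coe_oneHalf : (oneHalf : ℝ) = 1 / 2 := rfl

/-- The invariant of the loop of `RandBatch`. -/
structure LoopInv (𝓘 : Finset (Finset α)) (r : ℕ) (T A U L : Finset α) : Prop where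
  disjoint : Disjoint (T ∪ A) L
  feasible : ∀ u ∈ L, insert u (T ∪ A) ∈ 𝓘
  card_le : (T ∪ A).card ≤ r
  subset : A ⊆ U

lemma mem_valuable {X : Finset α} {u : α} :
    u ∈ valuable 𝓘 ρ f X L ↔ u ∈ L ∧ ρ ≤ gain f X u ∧ insert u X ∈ 𝓘 := Finset.mem_filter

lemma valuable_subset (X : Finset α) : valuable 𝓘 ρ f X L ⊆ L := Finset.filter_subset _ _

lemma batch_subset {l : List α} (hl : l ∈ orderings L) (s : ℕ) (t : ℕ × ℕ) :
    batch (l.take s) t ⊆ L := by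
  intro x hx
  rw [batch, List.mem_toFinset] at hx
  rw [← (mem_orderings.mp hl).2, List.mem_toFinset]
  exact List.mem_of_mem_take (List.mem_of_mem_take hx)

lemma length_take_le {l : List α} (hl : l ∈ orderings L) (s : ℕ) :
    (l.take s).length ≤ s ∧ (l.take s).length ≤ L.card := by
  have := length_of_mem_orderings hl
  rw [List.length_take]
  omega

lemma union_batch (X : Finset α) (V : List α) (t : ℕ × ℕ) :
    X ∪ batch V t = prefixSet X V (min t.1 t.2) := rfl

lemma card_union_batch_le {l : List α} (hl : l ∈ orderings L) {X : Finset α} (hX : X.card ≤ r)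
    (t : ℕ × ℕ) : (X ∪ batch (l.take (r - X.card)) t).card ≤ r := by
  refine (Finset.card_union_le _ _).trans ?_
  have h1 : (batch (l.take (r - X.card)) t).card ≤ r - X.card := by
    refine (List.toFinset_card_le _).trans ?_
    rw [List.length_take]
    exact (min_le_right _ _).trans (length_take_le hl _).1
  omega

lemma LoopInv.card_lt (h𝓘 : ∀ Y, Y ∈ 𝓘 ↔ Y.card ≤ r) (h : LoopInv 𝓘 r T A U L) (hL : L ≠ ∅) :
    (T ∪ A).card < r := by
  obtain ⟨u, hu⟩ := Finset.nonempty_iff_ne_empty.mpr hL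
  have h1 := h.feasible u hu
  rw [h𝓘, Finset.card_insert_of_notMem fun h2 => Finset.disjoint_left.mp h.disjoint h2 hu] at h1
  exact h1

lemma batch_nonempty (h𝓘 : ∀ Y, Y ∈ 𝓘 ↔ Y.card ≤ r) (h : LoopInv 𝓘 r T A U L) (hL : L ≠ ∅)
    {l : List α} (hl : l ∈ orderings L) {t : ℕ × ℕ} (h1 : 1 ≤ t.1) (h2 : 1 ≤ t.2) :
    (batch (l.take (r - (T ∪ A).card)) t).Nonempty := by
  have h3 := h.card_lt h𝓘 hL
  have h4 := length_of_mem_orderings hl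
  have h5 := Finset.card_pos.mpr (Finset.nonempty_iff_ne_empty.mpr hL)
  rw [batch, List.toFinset_nonempty_iff, ← List.length_pos_iff]
  simp only [List.length_take]
  omega

lemma LoopInv.reject (h : LoopInv 𝓘 r T A U L) (W : Finset α) :
    LoopInv 𝓘 r T A (U ∪ W) (valuable 𝓘 ρ f (T ∪ A) (L \ (U ∪ W))) where
  disjoint := h.disjoint.mono_right ((valuable_subset _).trans Finset.sdiff_subset)
  feasible _ hu := (mem_valuable.mp hu).2.2
  card_le := h.card_le
  subset := h.subset.trans Finset.subset_union_left

lemma LoopInv.accept (h : LoopInv 𝓘 r T A U L) {W : Finset α} (hW : (T ∪ A ∪ W).card ≤ r) :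
    LoopInv 𝓘 r T (A ∪ W) (U ∪ W) (valuable 𝓘 ρ f (T ∪ (A ∪ W)) (L \ (U ∪ W))) where
  disjoint := by
    rw [← Finset.union_assoc]
    refine Finset.disjoint_union_left.mpr ⟨?_, ?_⟩
    · exact h.disjoint.mono_right ((valuable_subset _).trans Finset.sdiff_subset)
    · exact (Finset.sdiff_disjoint.mono_right Finset.subset_union_right).symm.mono_right
        (valuable_subset _)
  feasible _ hu := (mem_valuable.mp hu).2.2
  card_le := by rwa [← Finset.union_assoc]
  subset := Finset.union_subset_union_left h.subset

lemma mean_randBatchLoop_succ (h𝓘 : ∀ Y, Y ∈ 𝓘 ↔ Y.card ≤ r) (h : LoopInv 𝓘 r T A U L)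
    (hL : L ≠ ∅) (hc : count < M) (K : Finset α × Finset α × Finset α → ℝ) :
    mean f (randBatchLoop mode 𝓘 ρ ε oneHalf M T (m + 1) A U L count) K =
      (∑ l ∈ orderings L, mean f (findIndices mode 𝓘 ρ ε (T ∪ A) (l.take (r - (T ∪ A).card)) L)
        fun t => 1 / 2 * mean f (randBatchLoop mode 𝓘 ρ ε oneHalf M T m
            (A ∪ batch (l.take (r - (T ∪ A).card)) t) (U ∪ batch (l.take (r - (T ∪ A).card)) t)
            (valuable 𝓘 ρ f (T ∪ (A ∪ batch (l.take (r - (T ∪ A).card)) t))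
              (L \ (U ∪ batch (l.take (r - (T ∪ A).card)) t)))
            (if t.2 < t.1 then count + 1 else count)) K +
          1 / 2 * mean f (randBatchLoop mode 𝓘 ρ ε oneHalf M T m
            A (U ∪ batch (l.take (r - (T ∪ A).card)) t)
            (valuable 𝓘 ρ f (T ∪ A) (L \ (U ∪ batch (l.take (r - (T ∪ A).card)) t)))
            count) K) / (orderings L).card := by
  obtain ⟨k, hk, hk'⟩ := getSeq_eq_shuffle h𝓘 h.card_le h.disjoint hL
  rw [randBatchLoop, if_neg (not_or.mpr ⟨hL, not_le.mpr hc⟩), mean_bind, hk, mean]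
  congr 1
  refine Finset.sum_congr rfl fun l hl => ?_
  rw [hk' l hl, mean, mean_bind]
  congr 1
  funext t
  simp only [mean, mean_bind, mean_queryValuable, coe_oneHalf, batch]
  norm_num

lemma meanCost_randBatchLoop_succ (h𝓘 : ∀ Y, Y ∈ 𝓘 ↔ Y.card ≤ r) (h : LoopInv 𝓘 r T A U L)
    (hL : L ≠ ∅) (hc : count < M) :
    meanCost c f (randBatchLoop mode 𝓘 ρ ε oneHalf M T (m + 1) A U L count) =
      (∑ l ∈ orderings L,
        (meanCost c f (findIndices mode 𝓘 ρ ε (T ∪ A) (l.take (r - (T ∪ A).card)) L) +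
        mean f (findIndices mode 𝓘 ρ ε (T ∪ A) (l.take (r - (T ∪ A).card)) L)
        fun t => 1 / 2 * (c (valuableSets (T ∪ (A ∪ batch (l.take (r - (T ∪ A).card)) t))
              (L \ (U ∪ batch (l.take (r - (T ∪ A).card)) t))) +
            meanCost c f (randBatchLoop mode 𝓘 ρ ε oneHalf M T m
            (A ∪ batch (l.take (r - (T ∪ A).card)) t) (U ∪ batch (l.take (r - (T ∪ A).card)) t)
            (valuable 𝓘 ρ f (T ∪ (A ∪ batch (l.take (r - (T ∪ A).card)) t))
              (L \ (U ∪ batch (l.take (r - (T ∪ A).card)) t)))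
            (if t.2 < t.1 then count + 1 else count))) +
          1 / 2 * (c (valuableSets (T ∪ A) (L \ (U ∪ batch (l.take (r - (T ∪ A).card)) t))) +
            meanCost c f (randBatchLoop mode 𝓘 ρ ε oneHalf M T m
            A (U ∪ batch (l.take (r - (T ∪ A).card)) t)
            (valuable 𝓘 ρ f (T ∪ A) (L \ (U ∪ batch (l.take (r - (T ∪ A).card)) t)))
            count)))) / (orderings L).card := by
  obtain ⟨k, hk, hk'⟩ := getSeq_eq_shuffle h𝓘 h.card_le h.disjoint hL
  have h0 : ∑ l ∈ orderings L, meanCost c f (k l) = 0 :=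
    Finset.sum_eq_zero fun l hl => by rw [hk' l hl, meanCost]
  rw [randBatchLoop, if_neg (not_or.mpr ⟨hL, not_le.mpr hc⟩), meanCost_bind, hk, mean, meanCost, h0,
    zero_div, zero_add]
  congr 1
  refine Finset.sum_congr rfl fun l hl => ?_
  rw [hk' l hl, mean, meanCost_bind]
  congr 2
  funext t
  simp only [meanCost, meanCost_bind, mean_queryValuable, meanCost_queryValuable, coe_oneHalf,
    batch]
  norm_num

lemma always_randBatchLoop (h𝓘 : ∀ Y, Y ∈ 𝓘 ↔ Y.card ≤ r) (hN : (N + 1) * (N + 1) ≤ m)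
    (p : unitInterval) (k : ℕ) (h : LoopInv 𝓘 r T A U L) (hLN : L.card ≤ N) :
    Always f m (randBatchLoop mode 𝓘 ρ ε p M T k A U L count) fun R =>
      LoopInv 𝓘 r T R.1 R.2.1 R.2.2 := by
  induction k generalizing A U L count with
  | zero => exact h
  | succ k ih =>
    rw [randBatchLoop]
    split_ifs with hif
    · exact h
    rw [not_or, not_le] at hif
    obtain ⟨q, hq, hq'⟩ := getSeq_eq_shuffle h𝓘 h.card_le h.disjoint hif.1
    rw [hq]
    intro l hl
    change Always f m ((q l).bind _) _
    rw [hq' l hl]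
    have hlen := length_take_le hl (r - (T ∪ A).card)
    have hLm : (((l.take (r - (T ∪ A).card)).length + 1) * (L.card + 1)) ≤ m :=
      le_trans (Nat.mul_le_mul (by omega) (by omega)) hN
    refine (always_findIndices mode hLm).bind fun t ht b => ?_
    have hcard : ∀ W : Finset α, (L \ W).card ≤ N := fun W =>
      (Finset.card_le_card Finset.sdiff_subset).trans hLN
    cases b with
    | true =>
      refine (always_queryValuable _ _ ?_).bind ?_
      · have := hcard (U ∪ (List.take (min t.1 t.2) (l.take (r - (T ∪ A).card))).toFinset)
        nlinarith
      · rintro L' rfl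
        exact ih (h.accept (card_union_batch_le hl h.card_le t))
          ((Finset.card_le_card (valuable_subset _)).trans (hcard _))
    | false =>
      refine (always_queryValuable _ _ ?_).bind ?_
      · have := hcard (U ∪ (List.take (min t.1 t.2) (l.take (r - (T ∪ A).card))).toFinset)
        nlinarith
      · rintro L' rfl
        exact ih (h.reject _) ((Finset.card_le_card (valuable_subset _)).trans (hcard _))

lemma LoopInv.initial {I : Finset α} (hT : T.card ≤ r) (hTI : Disjoint T I) :
    LoopInv 𝓘 r T ∅ ∅ (valuable 𝓘 ρ f T I) where
  disjoint := by
    rw [Finset.union_empty]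
    exact hTI.mono_right (valuable_subset _)
  feasible _ hu := by
    rw [Finset.union_empty]
    exact (mem_valuable.mp hu).2.2
  card_le := by rwa [Finset.union_empty]
  subset := Finset.empty_subset _

lemma LoopInv.disjoint_next {I : Finset α} (h : LoopInv 𝓘 r T A U L) (hTI : Disjoint T I) :
    Disjoint (T ∪ A) (I \ (U ∪ L)) := by
  refine Finset.disjoint_union_left.mpr ⟨hTI.mono_right Finset.sdiff_subset, ?_⟩
  exact (Finset.sdiff_disjoint.mono_right (h.subset.trans Finset.subset_union_left)).symm

lemma always_randBatch (h𝓘 : ∀ Y, Y ∈ 𝓘 ↔ Y.card ≤ r) (hN : (N + 1) * (N + 1) ≤ m)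
    (p : unitInterval) {I : Finset α} (hT : T.card ≤ r) (hTI : Disjoint T I) (hI : I.card ≤ N) :
    Always f m (randBatch mode 𝓘 ρ ε p M T I) fun R => LoopInv 𝓘 r T R.1 R.2.1 R.2.2 := by
  refine (always_queryValuable T I (by nlinarith)).bind ?_
  rintro L rfl
  exact always_randBatchLoop h𝓘 hN p _ (LoopInv.initial hT hTI)
    ((Finset.card_le_card (valuable_subset _)).trans hI)

lemma always_parSSPLoop (h𝓘 : ∀ Y, Y ∈ 𝓘 ↔ Y.card ≤ r) (hN : (N + 1) * (N + 1) ≤ m)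
    (p : unitInterval) (ρmax : ℝ) (k j : ℕ) {I : Finset α} (hT : T.card ≤ r)
    (hTI : Disjoint T I) (hI : I.card ≤ N) :
    Always f m (parSSPLoop mode 𝓘 ρmax ε p M k j T I) fun S => S.card ≤ r := by
  induction k generalizing j T I with
  | zero => exact hT
  | succ k ih =>
    refine (always_randBatch h𝓘 hN p hT hTI hI).bind fun R hR => ?_
    exact ih _ hR.card_le (hR.disjoint_next hTI)
      ((Finset.card_le_card Finset.sdiff_subset).trans hI)

end Step

/-! ### Expected cost -/

lemma one_le_card {α : Type u} {L : Finset α} (hL : L ≠ ∅) : (1 : ℝ) ≤ L.card := by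
  exact_mod_cast Finset.card_pos.mpr (Finset.nonempty_iff_ne_empty.mpr hL)

section Complexity

variable {α : Type u} [DecidableEq α] {f : Finset α → ℝ} {𝓘 : Finset (Finset α)} {ρ ε : ℝ}
  {T A U L : Finset α} {r M N count : ℕ} {c : Finset (Finset α) → ℝ} {mode : SearchMode}

/-- A potential that drops by `1` in each iteration of `RandBatch` whose coin shows `true`. -/
noncomputable def potential (ε : ℝ) (M count : ℕ) (L : Finset α) : ℝ :=
  if L = ∅ ∨ M ≤ count then 0
  else 1 + Real.log L.card / (-Real.log (1 - ε)) + ((M : ℝ) - count)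

lemma neg_log_one_sub_pos (hε0 : 0 < ε) (hε1 : ε < 1) : 0 < -Real.log (1 - ε) := by
  have := Real.log_neg (x := 1 - ε) (by linarith) (by linarith)
  linarith

lemma potential_nonneg (hε0 : 0 < ε) (hε1 : ε < 1) (L : Finset α) : 0 ≤ potential ε M count L := by
  unfold potential
  split_ifs with h
  · exact le_rfl
  · rw [not_or, not_le] at h
    have h1 := div_nonneg (Real.log_nonneg (one_le_card h.1)) (neg_log_one_sub_pos hε0 hε1).le
    have h2 : (count : ℝ) < M := by exact_mod_cast h.2
    linarith

lemma potential_mono (hε0 : 0 < ε) (hε1 : ε < 1) {L' : Finset α} (hL : L' ⊆ L) :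
    potential ε M count L' ≤ potential ε M count L := by
  by_cases h : L' = ∅ ∨ M ≤ count
  · rw [potential, if_pos h]
    exact potential_nonneg hε0 hε1 L
  · have h' := h
    rw [not_or, not_le] at h
    have hL0 : ¬ (L = ∅ ∨ M ≤ count) := by
      rw [not_or, not_le]
      exact ⟨fun h0 => h.1 (Finset.subset_empty.mp (h0 ▸ hL)), h.2⟩
    rw [potential, if_neg h', potential, if_neg hL0]
    have h1 : Real.log L'.card ≤ Real.log L.card :=
      Real.log_le_log (by linarith [one_le_card h.1]) (by exact_mod_cast Finset.card_le_card hL)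
    have := div_le_div_of_nonneg_right h1 (neg_log_one_sub_pos hε0 hε1).le
    linarith

lemma potential_le (hε0 : 0 < ε) (hε1 : ε < 1) (hLN : L.card ≤ N) (hN : 1 ≤ N) :
    potential ε M count L ≤ 1 + Real.log N / (-Real.log (1 - ε)) + M := by
  have hN' : (1 : ℝ) ≤ N := by exact_mod_cast hN
  have hl := neg_log_one_sub_pos hε0 hε1
  unfold potential
  split_ifs with h
  · have := div_nonneg (Real.log_nonneg hN') hl.le
    positivity
  · rw [not_or] at h
    have h1 : Real.log L.card ≤ Real.log N :=
      Real.log_le_log (by linarith [one_le_card h.1]) (by exact_mod_cast hLN)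
    have := div_le_div_of_nonneg_right h1 hl.le
    have h2 : (0 : ℝ) ≤ count := Nat.cast_nonneg _
    linarith

/-- If `t₂ < t₁`, then `count` grows. Otherwise `t₁` is the stopping index: either `costCond` holds
there, `L` shrinks by the factor `1 - ε` and the logarithmic term loses 1, or no index stopped and
no candidate is left. -/
lemma potential_accept_le (h𝓘 : ∀ Y, Y ∈ 𝓘 ↔ Y.card ≤ r) (hε0 : 0 < ε) (hε1 : ε < 1)
    (h : LoopInv 𝓘 r T A U L) (hL : L ≠ ∅) (hc : count < M) {l : List α} (hl : l ∈ orderings L)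
    {t : ℕ × ℕ} {V : List α} (hV : V = l.take (r - (T ∪ A).card))
    (ht : IndexSpec V.length (costCond 𝓘 ρ ε f (T ∪ A) V L) t.1) :
    potential ε M (if t.2 < t.1 then count + 1 else count)
      (valuable 𝓘 ρ f (T ∪ (A ∪ batch V t)) (L \ (U ∪ batch V t))) ≤ potential ε M count L - 1 := by
  have hlam := neg_log_one_sub_pos hε0 hε1
  set L' := valuable 𝓘 ρ f (T ∪ (A ∪ batch V t)) (L \ (U ∪ batch V t)) with hL'
  have hsub : L' ⊆ L := (valuable_subset _).trans Finset.sdiff_subset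
  have hcM : (count : ℝ) + 1 ≤ M := by exact_mod_cast hc
  have hlog := div_nonneg (Real.log_nonneg (one_le_card hL)) hlam.le
  have hpot : potential ε M count L =
      1 + Real.log L.card / (-Real.log (1 - ε)) + ((M : ℝ) - count) := by
    rw [potential, if_neg (not_or.mpr ⟨hL, not_le.mpr hc⟩)]
  by_cases h0 : L' = ∅ ∨ M ≤ if t.2 < t.1 then count + 1 else count
  · rw [potential, if_pos h0, hpot]
    linarith
  rw [hpot, potential, if_neg h0]
  rw [not_or, not_le] at h0
  have hL'1 := one_le_card h0.1
  have hle : (L'.card : ℝ) ≤ L.card := by exact_mod_cast Finset.card_le_card hsub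
  split_ifs with hlt
  · have h1 : Real.log L'.card ≤ Real.log L.card := Real.log_le_log (by linarith) hle
    have := div_le_div_of_nonneg_right h1 hlam.le
    push_cast
    linarith
  · have hmin : min t.1 t.2 = t.1 := min_eq_left (not_lt.mp hlt)
    rcases ht.2.2.1 with hcost | hend
    · have h1 : (L'.card : ℝ) ≤ (1 - ε) * L.card := by
        refine le_trans ?_ hcost
        have : L' ⊆ valuable 𝓘 ρ f (prefixSet (T ∪ A) V t.1) L := by
          intro u hu
          have hG : T ∪ (A ∪ batch V t) = prefixSet (T ∪ A) V t.1 := by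
            rw [← Finset.union_assoc, union_batch, hmin]
          rw [hL', hG, mem_valuable] at hu
          exact mem_valuable.mpr ⟨(Finset.mem_sdiff.mp hu.1).1, hu.2⟩
        exact_mod_cast Finset.card_le_card this
      have h2 : Real.log L'.card ≤ Real.log (1 - ε) + Real.log L.card := by
        rw [← Real.log_mul (by linarith) (by linarith [one_le_card hL])]
        exact Real.log_le_log (by linarith) h1
      have h3 := div_le_div_of_nonneg_right h2 hlam.le
      have h4 : (Real.log (1 - ε) + Real.log L.card) / (-Real.log (1 - ε)) =
          Real.log L.card / (-Real.log (1 - ε)) - 1 := by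
        rw [add_div, div_neg, div_self (by linarith)]
        ring
      rw [h4] at h3
      linarith
    -- Here `t₁ = d + 1`, so the whole sequence was accepted; it cannot be extended, contradicting
    -- that a feasible candidate remains.
    · exfalso
      have hW : batch V t = V.toFinset := by
        rw [batch, hmin, List.take_of_length_le (by omega)]
      obtain ⟨u, hu⟩ := Finset.nonempty_iff_ne_empty.mpr h0.1
      rw [hL', mem_valuable, hW, ← Finset.union_assoc] at hu
      obtain ⟨hu1, -, hu3⟩ := hu
      rw [Finset.mem_sdiff, Finset.mem_union, not_or, List.mem_toFinset] at hu1
      rw [hV] at hu1 hu3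
      exact insert_notMem_of_notMem_take h𝓘 h.card_le h.disjoint hl hu1.1 hu1.2.2 hu3

/-- An accepted iteration lowers the potential by at least 1 and a rejected one does not raise it.
The expected drop is therefore at least 1/2, whence the factor 2. -/
lemma meanCost_randBatchLoop_le (h𝓘 : ∀ Y, Y ∈ 𝓘 ↔ Y.card ≤ r) (hε0 : 0 < ε) (hε1 : ε < 1)
    {κ₁ κ₂ : ℝ} (h1 : 0 ≤ κ₁) (h2 : 0 ≤ κ₂)
    (hfind : ∀ (X L : Finset α) (V : List α), V.length ≤ r → V.length ≤ L.card → L.card ≤ N →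
      meanCost c f (findIndices mode 𝓘 ρ ε X V L) ≤ κ₁)
    (hq : ∀ Q, Q.card ≤ N + 1 → c Q ≤ κ₂) (k : ℕ)
    (h : LoopInv 𝓘 r T A U L) (hLN : L.card ≤ N) :
    meanCost c f (randBatchLoop mode 𝓘 ρ ε oneHalf M T k A U L count) ≤
      2 * (κ₁ + κ₂) * potential ε M count L := by
  induction k generalizing A U L count with
  | zero =>
    rw [randBatchLoop, meanCost]
    have := potential_nonneg (M := M) (count := count) hε0 hε1 L
    positivity
  | succ k ih =>
    by_cases h0 : L = ∅ ∨ M ≤ count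
    · rw [randBatchLoop, if_pos h0, meanCost]
      have := potential_nonneg (M := M) (count := count) hε0 hε1 L
      positivity
    rw [not_or, not_le] at h0
    rw [meanCost_randBatchLoop_succ h𝓘 h h0.1 h0.2, div_le_iff₀ (orderings_card_pos L),
      mul_comm, ← nsmul_eq_mul]
    refine Finset.sum_le_card_nsmul _ _ _ fun l hl => ?_
    set V := l.take (r - (T ∪ A).card) with hV
    have hlen := length_take_le hl (r - (T ∪ A).card)
    rw [← hV] at hlen
    have e1 := hfind (T ∪ A) L V (by omega) (by omega) hLN
    have hcard : ∀ W : Finset α, (L \ W).card ≤ N := fun W =>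
      (Finset.card_le_card Finset.sdiff_subset).trans hLN
    have hcq : ∀ X W : Finset α, c (valuableSets X (L \ W)) ≤ κ₂ := fun X W =>
      hq _ ((card_valuableSets_le _ _).trans (Nat.add_le_add_right (hcard W) 1))
    refine (add_le_add e1 ((mean_mono (always_findIndices mode le_rfl) fun t ht => ?_).trans_eq
      (mean_const _ (2 * (κ₁ + κ₂) * potential ε M count L - κ₁)))).trans_eq (by ring)
    have hacc := potential_accept_le h𝓘 hε0 hε1 h h0.1 h0.2 hl hV ht.1
    have e2 := ih (count := if t.2 < t.1 then count + 1 else count)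
      (h.accept (ρ := ρ) (f := f) (card_union_batch_le hl h.card_le t))
      ((Finset.card_le_card (valuable_subset _)).trans (hcard _))
    have e3 := ih (count := count) (h.reject (ρ := ρ) (f := f) (batch V t))
      ((Finset.card_le_card (valuable_subset _)).trans (hcard _))
    have e4 := potential_mono (M := M) (count := count) hε0 hε1
      ((valuable_subset (𝓘 := 𝓘) (ρ := ρ) (f := f) (T ∪ A)).trans
        (Finset.sdiff_subset (s := L) (t := U ∪ batch V t)))
    have e5 := mul_le_mul_of_nonneg_left hacc (show 0 ≤ 2 * (κ₁ + κ₂) by positivity)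
    have e6 := mul_le_mul_of_nonneg_left e4 (show 0 ≤ 2 * (κ₁ + κ₂) by positivity)
    have e7 := hcq (T ∪ (A ∪ batch V t)) (U ∪ batch V t)
    have e8 := hcq (T ∪ A) (U ∪ batch V t)
    linarith

lemma meanCost_parSSPLoop_le (h𝓘 : ∀ Y, Y ∈ 𝓘 ↔ Y.card ≤ r) (hε0 : 0 < ε) (hε1 : ε < 1)
    {κ₁ κ₂ : ℝ} (h1 : 0 ≤ κ₁) (h2 : 0 ≤ κ₂)
    (hfind : ∀ (ρ : ℝ) (X L : Finset α) (V : List α), V.length ≤ r → V.length ≤ L.card →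
      L.card ≤ N → meanCost c f (findIndices mode 𝓘 ρ ε X V L) ≤ κ₁)
    (hq : ∀ Q, Q.card ≤ N + 1 → c Q ≤ κ₂) (hN : 1 ≤ N) (ρmax : ℝ) (k j : ℕ) {I : Finset α}
    (hT : T.card ≤ r) (hTI : Disjoint T I) (hI : I.card ≤ N) :
    meanCost c f (parSSPLoop mode 𝓘 ρmax ε oneHalf M k j T I) ≤
      k * (κ₂ + 2 * (κ₁ + κ₂) * (1 + Real.log N / (-Real.log (1 - ε)) + M)) := by
  induction k generalizing j T I with
  | zero => simp [parSSPLoop, meanCost]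
  | succ k ih =>
    rw [parSSPLoop, meanCost_bind]
    have e1 : meanCost c f (randBatch mode 𝓘 (ρmax * (1 - ε) ^ j) ε oneHalf M T I) ≤
        κ₂ + 2 * (κ₁ + κ₂) * (1 + Real.log N / (-Real.log (1 - ε)) + M) := by
      rw [randBatch, meanCost_bind, meanCost_queryValuable, mean_queryValuable]
      have hLN := (Finset.card_le_card (valuable_subset (𝓘 := 𝓘) (ρ := ρmax * (1 - ε) ^ j)
        (f := f) (L := I) T)).trans hI
      refine add_le_add (hq _ ((card_valuableSets_le _ _).trans (by omega))) ?_
      refine (meanCost_randBatchLoop_le h𝓘 hε0 hε1 h1 h2 (hfind _) hq _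
        (LoopInv.initial hT hTI) hLN).trans ?_
      exact mul_le_mul_of_nonneg_left (potential_le hε0 hε1 hLN hN) (by positivity)
    have e2 := (mean_mono (always_randBatch (mode := mode) (f := f) (ρ := ρmax * (1 - ε) ^ j)
      (ε := ε) (M := M) h𝓘 le_rfl oneHalf hT hTI hI) fun R hR => ih (j + 1) hR.card_le
        (hR.disjoint_next hTI) ((Finset.card_le_card Finset.sdiff_subset).trans hI)).trans_eq
      (mean_const _ _)
    push_cast
    linarith

lemma meanCost_parSSP_le [Fintype α] [Nonempty α] (h𝓘 : ∀ Y, Y ∈ 𝓘 ↔ Y.card ≤ r)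
    (hr : rank 𝓘 = r) (hε0 : 0 < ε) (hε1 : ε < 1) {κ₁ κ₂ : ℝ} (h1 : 0 ≤ κ₁) (h2 : 0 ≤ κ₂)
    (hfind : ∀ (ρ : ℝ) (X L : Finset α) (V : List α), V.length ≤ r → V.length ≤ L.card →
      L.card ≤ Fintype.card α → meanCost c f (findIndices mode 𝓘 ρ ε X V L) ≤ κ₁)
    (hq : ∀ Q, Q.card ≤ Fintype.card α + 1 → c Q ≤ κ₂) :
    meanCost c f (parSSP mode 𝓘 oneHalf ε) ≤ 2 * κ₂ +
      (⌈Real.logb (1 - ε) (ε / r)⌉₊ + 1 : ℕ) * (κ₂ + 2 * (κ₁ + κ₂) *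
        (1 + Real.log (Fintype.card α) / (-Real.log (1 - ε)) +
          ⌈(Real.logb (1 - ε) (ε / r) + 2) / ε ^ 2⌉₊)) := by
  have hN : 1 ≤ Fintype.card α := Fintype.card_pos
  rw [parSSP, hr]
  simp only [meanCost, meanCost_bind]
  have e1 : c (univ.image fun u : α => ({u} : Finset α)) ≤ κ₂ :=
    hq _ (Finset.card_image_le.trans (by simp))
  have e2 : ∀ S S' : Finset α, c {S, S'} ≤ κ₂ := fun S S' =>
    hq _ (Finset.card_le_two.trans (by omega))
  have e3 := fun ρmax : ℝ => meanCost_parSSPLoop_le (f := f) (c := c) (mode := mode)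
    (M := ⌈(Real.logb (1 - ε) (ε / r) + 2) / ε ^ 2⌉₊) h𝓘 hε0 hε1 h1 h2 hfind hq hN ρmax
    (⌈Real.logb (1 - ε) (ε / r)⌉₊ + 1) 0 (T := ∅) (I := univ) (by simp) (by simp)
    (Finset.card_univ.le)
  have e4 : ∀ (a : OracleAlg α (Finset α)) (S : Finset α),
      mean f a (fun T => c {T, S} + 0) ≤ κ₂ := fun a S =>
    (mean_mono_of_le fun T => by rw [add_zero]; exact e2 T S).trans_eq (mean_const a κ₂)
  refine (add_le_add e1 (add_le_add (e3 _) (e4 _ _))).trans_eq ?_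
  ring

end Complexity

/-! ### Logarithmic bounds -/

section Numeric

variable {ε : ℝ}

lemma half_le_log_add_one {n : ℕ} (hn : 1 ≤ n) : 1 / 2 ≤ Real.log (n + 1) := by
  have h1 : (2 : ℝ) ≤ n + 1 := by
    have : (1 : ℝ) ≤ n := by exact_mod_cast hn
    linarith
  have := Real.log_le_log (by norm_num) h1
  linarith [Real.log_two_gt_d9]

lemma logb_eq (hε0 : 0 < ε) {r : ℕ} (hr : 1 ≤ r) :
    Real.logb (1 - ε) (ε / r) = (Real.log r - Real.log ε) / (-Real.log (1 - ε)) := by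
  have hr' : (r : ℝ) ≠ 0 := by positivity
  rw [Real.logb, Real.log_div hε0.ne' hr', div_neg, ← neg_div, neg_sub]

lemma logb_nonneg_of_rank (hε0 : 0 < ε) (hε1 : ε < 1) {r : ℕ} (hr : 1 ≤ r) :
    0 ≤ Real.logb (1 - ε) (ε / r) := by
  rw [logb_eq hε0 hr]
  have h1 : (1 : ℝ) ≤ r := by exact_mod_cast hr
  have h2 := Real.log_nonneg h1
  have h3 := Real.log_neg hε0 hε1
  exact div_nonneg (by linarith) (neg_log_one_sub_pos hε0 hε1).le

/-- Since `log (n + 1) ≥ 1/2`, every additive constant is absorbed into a multiple of the logarithm.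
The number of thresholds and the potential contribute one logarithm each. -/
lemma exists_total_cost_bound (hε0 : 0 < ε) (hε1 : ε < 1) :
    ∃ C : ℝ, 0 < C ∧ ∀ (n r : ℕ) (κ₁ κ₂ : ℝ), 1 ≤ r → r ≤ n → 0 ≤ κ₁ → 0 ≤ κ₂ →
      2 * κ₂ + (⌈Real.logb (1 - ε) (ε / r)⌉₊ + 1 : ℕ) * (κ₂ + 2 * (κ₁ + κ₂) *
        (1 + Real.log n / (-Real.log (1 - ε)) +
          ⌈(Real.logb (1 - ε) (ε / r) + 2) / ε ^ 2⌉₊)) ≤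
      C * ((κ₁ + κ₂) * Real.log (n + 1) ^ 2) := by
  have hlam := neg_log_one_sub_pos hε0 hε1
  set lam := -Real.log (1 - ε) with hlamdef
  have hle := Real.log_neg hε0 hε1
  -- With `1 ≤ 2 * D`: `log r - log ε ≤ (1 - 2 * log ε) * D`, and the summand 2 is at most `4 * D`.
  set C₁ := (1 - 2 * Real.log ε) / lam + 4 with hC₁
  have hC₁pos : 0 < C₁ := by
    have : 0 ≤ (1 - 2 * Real.log ε) / lam := div_nonneg (by linarith) hlam.le
    linarith
  set C₂ := 2 + 1 / lam + (C₁ / ε ^ 2 + 2) with hC₂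
  have hC₂pos : 0 < C₂ := by positivity
  refine ⟨C₁ * (2 + 2 * C₂) + 8, by positivity, fun n r κ₁ κ₂ hr hrn h1 h2 => ?_⟩
  set D := Real.log (n + 1) with hD
  have hDhalf : 1 / 2 ≤ D := half_le_log_add_one (hr.trans hrn)
  have hn1 : (1 : ℝ) ≤ n := by exact_mod_cast hr.trans hrn
  have hlogn : Real.log n ≤ D := Real.log_le_log (by linarith) (by linarith)
  have hlogr : Real.log r ≤ D := by
    have : (1 : ℝ) ≤ r := by exact_mod_cast hr
    have h3 : (r : ℝ) ≤ n := by exact_mod_cast hrn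
    exact (Real.log_le_log (by linarith) h3).trans hlogn
  have hlg0 := logb_nonneg_of_rank hε0 hε1 hr
  have hlg : Real.logb (1 - ε) (ε / r) + 2 ≤ C₁ * D := by
    rw [logb_eq hε0 hr, ← hlamdef]
    have e1 : Real.log r - Real.log ε ≤ (1 - 2 * Real.log ε) * D := by nlinarith
    have e2 := div_le_div_of_nonneg_right e1 hlam.le
    rw [hC₁]
    have e3 : (1 - 2 * Real.log ε) * D / lam = (1 - 2 * Real.log ε) / lam * D := by ring
    rw [e3] at e2
    linarith
  have hell : ((⌈Real.logb (1 - ε) (ε / r)⌉₊ + 1 : ℕ) : ℝ) ≤ C₁ * D := by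
    have := Nat.ceil_lt_add_one hlg0
    push_cast
    linarith
  have hM : ((⌈(Real.logb (1 - ε) (ε / r) + 2) / ε ^ 2⌉₊ : ℕ) : ℝ) ≤ (C₁ / ε ^ 2 + 2) * D := by
    have e1 := (Nat.ceil_lt_add_one (a := (Real.logb (1 - ε) (ε / r) + 2) / ε ^ 2)
      (by positivity)).le
    have e2 := div_le_div_of_nonneg_right hlg (show 0 ≤ ε ^ 2 by positivity)
    have e3 : C₁ * D / ε ^ 2 = C₁ / ε ^ 2 * D := by ring
    rw [e3] at e2
    linarith
  have hΦ : 1 + Real.log n / lam + ⌈(Real.logb (1 - ε) (ε / r) + 2) / ε ^ 2⌉₊ ≤ C₂ * D := by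
    have e1 := div_le_div_of_nonneg_right hlogn hlam.le
    have e3 : D / lam = 1 / lam * D := by ring
    rw [e3] at e1
    rw [hC₂]
    linarith
  have hκ : 0 ≤ κ₁ + κ₂ := by linarith
  have hA : κ₂ + 2 * (κ₁ + κ₂) *
      (1 + Real.log n / lam + ⌈(Real.logb (1 - ε) (ε / r) + 2) / ε ^ 2⌉₊) ≤
      (κ₁ + κ₂) * (2 + 2 * C₂) * D := by
    have e1 := mul_le_mul_of_nonneg_left hΦ (show 0 ≤ 2 * (κ₁ + κ₂) by linarith)
    nlinarith
  have hB := mul_le_mul hell hA (by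
    have : 0 ≤ Real.log n / lam := div_nonneg (Real.log_nonneg hn1) hlam.le
    positivity) (by positivity)
  have hE : 2 * κ₂ ≤ 8 * ((κ₁ + κ₂) * D ^ 2) := by
    have : 1 / 4 ≤ D ^ 2 := by nlinarith
    nlinarith
  calc _ ≤ 8 * ((κ₁ + κ₂) * D ^ 2) + C₁ * D * ((κ₁ + κ₂) * (2 + 2 * C₂) * D) := add_le_add hE hB
    _ = _ := by ring

lemma natLog_add_one_le {d r : ℕ} (hr : 1 ≤ r) (hd : d ≤ r) :
    (Nat.log 2 d + 1 : ℝ) ≤ 4 * Real.log (r + 1) := by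
  have h1 := half_le_log_add_one hr
  have h2 : Nat.log 2 d ≤ Nat.log 2 r := Nat.log_mono_right hd
  have h3 : ((2 : ℝ) ^ Nat.log 2 r) ≤ r + 1 := by
    have : 2 ^ Nat.log 2 r ≤ r := Nat.pow_log_le_self 2 (by omega)
    have h4 : ((2 : ℝ) ^ Nat.log 2 r) ≤ r := by exact_mod_cast this
    linarith
  have h4 := Real.log_le_log (by positivity) h3
  rw [Real.log_pow] at h4
  have h5 : (Nat.log 2 d : ℝ) ≤ Nat.log 2 r := by exact_mod_cast h2
  have h6 : (0 : ℝ) ≤ Nat.log 2 r := Nat.cast_nonneg _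
  nlinarith [Real.log_two_gt_d9]

end Numeric

/-! ### The expected gain of a batch -/

section BatchGain

variable {α : Type u} [DecidableEq α] {f : Finset α → ℝ} {𝓘 : Finset (Finset α)} {ρ ε : ℝ}
  {X L : Finset α} {r : ℕ}

lemma prefixSet_take (l : List α) {i j : ℕ} (hij : j ≤ i) :
    prefixSet X (l.take i) j = prefixSet X l j := by
  unfold prefixSet
  rw [List.take_take, min_eq_left hij]

lemma costCond_take (l : List α) {i j : ℕ} (hij : j ≤ i) :
    costCond 𝓘 ρ ε f X (l.take i) L j ↔ costCond 𝓘 ρ ε f X l L j := by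
  unfold costCond
  rw [prefixSet_take l hij]

lemma valueCond_take (l : List α) {i j : ℕ} (hij : j ≤ i) :
    valueCond 𝓘 ρ ε f X (l.take i) L j ↔ valueCond 𝓘 ρ ε f X l L j := by
  have h : dropSum f X (l.take i) j = dropSum f X l j := by
    rw [dropSum_eq, dropSum_eq]
    refine Finset.sum_congr rfl fun k hk => ?_
    rw [Finset.mem_range] at hk
    rw [prefixSet_take l (by omega), prefixSet_take l (by omega)]
  unfold valueCond
  rw [prefixSet_take l hij, h]

/-- Neither of the two stopping conditions holds at a positive index up to the length of `P`. -/
def NotStopped (𝓘 : Finset (Finset α)) (ρ ε : ℝ) (f : Finset α → ℝ) (X L : Finset α)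
    (P : List α) : Prop :=
  ∀ j, 1 ≤ j → j ≤ P.length → ¬ costCond 𝓘 ρ ε f X P L j ∧ ¬ valueCond 𝓘 ρ ε f X P L j

/-- While neither condition holds, at least `(1 - ε) |L|` candidates have gain at least `ρ`, and the
negative gains cost at most the fraction `ε` of the total of these gains. The two factors `1 - ε`
give the square. -/
lemma sum_gain_nonneg (hρ : 0 < ρ) (hε0 : 0 < ε) (hε1 : ε < 1)
    (hL : ∀ u ∈ L, ρ ≤ gain f X u ∧ insert u X ∈ 𝓘) {P : List α}
    (hns : NotStopped 𝓘 ρ ε f X L P) :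
    0 ≤ ∑ v ∈ L \ P.toFinset, (gain f (X ∪ P.toFinset) v - (1 - ε) ^ 2 * ρ) := by
  have hG : X ∪ P.toFinset = prefixSet X P P.length := by simp [prefixSet]
  set G := X ∪ P.toFinset with hGdef
  have hcost : (1 - ε) * L.card ≤ (valuable 𝓘 ρ f G L).card := by
    -- Index 0 is never tested; there the bound holds because every element of `L` is still
    -- valuable.
    rcases Nat.eq_zero_or_pos P.length with h | h
    · have hP : P = [] := List.length_eq_zero_iff.mp h
      have : valuable 𝓘 ρ f G L = L := by
        rw [valuable, Finset.filter_eq_self]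
        simpa [hGdef, hP] using hL
      rw [this]
      have : (0 : ℝ) ≤ L.card := Nat.cast_nonneg _
      nlinarith
    · have := (hns _ h le_rfl).1
      rw [costCond, ← hG] at this
      exact (not_le.mp this).le
  have hvalue : ∑ u ∈ L, max (-gain f G u) 0 ≤ ε * ∑ u ∈ valuable 𝓘 ρ f G L, gain f G u := by
    rcases Nat.eq_zero_or_pos P.length with h | h
    · have hP : P = [] := List.length_eq_zero_iff.mp h
      have h1 : ∑ u ∈ L, max (-gain f G u) 0 = 0 := by
        refine Finset.sum_eq_zero fun u hu => max_eq_right ?_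
        have := (hL u hu).1
        simp only [hGdef, hP, List.toFinset_nil, Finset.union_empty]
        linarith
      rw [h1]
      refine mul_nonneg hε0.le (Finset.sum_nonneg fun u hu => ?_)
      exact hρ.le.trans (mem_valuable.mp hu).2.1
    · have := (hns _ h le_rfl).2
      rw [valueCond, ← hG, sum_negative_eq, dropSum_eq] at this
      have h2 : 0 ≤ ∑ j ∈ range P.length,
          max (f (prefixSet X P j) - f (prefixSet X P (j + 1))) 0 :=
        Finset.sum_nonneg fun _ _ => le_max_right _ _
      linarith
  -- Elements already drawn have gain 0, so the sum may run over all of `L`.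
  have h1 : ∑ v ∈ L \ P.toFinset, gain f G v = ∑ v ∈ L, gain f G v := by
    refine Finset.sum_subset Finset.sdiff_subset fun v hv hv' => gain_of_mem ?_
    rw [Finset.mem_sdiff, not_and_not_right] at hv'
    exact Finset.mem_union_right _ (hv' hv)
  have h2 : ∑ u ∈ valuable 𝓘 ρ f G L, gain f G u - ∑ u ∈ L, max (-gain f G u) 0 ≤
      ∑ v ∈ L, gain f G v := by
    have : ∑ u ∈ valuable 𝓘 ρ f G L, gain f G u =
        ∑ u ∈ L, if ρ ≤ gain f G u ∧ insert u G ∈ 𝓘 then gain f G u else 0 := by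
      rw [valuable, Finset.sum_filter]
    rw [this, ← Finset.sum_sub_distrib]
    refine Finset.sum_le_sum fun u _ => ?_
    split_ifs
    · linarith [le_max_right (-gain f G u) 0]
    · linarith [le_max_left (-gain f G u) 0]
  have h3 : ρ * (valuable 𝓘 ρ f G L).card ≤ ∑ u ∈ valuable 𝓘 ρ f G L, gain f G u := by
    rw [mul_comm, ← nsmul_eq_mul]
    exact Finset.card_nsmul_le_sum _ _ _ fun u hu => (mem_valuable.mp hu).2.1
  have h4 : ((L \ P.toFinset).card : ℝ) ≤ L.card := by
    exact_mod_cast Finset.card_le_card Finset.sdiff_subset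
  rw [Finset.sum_sub_distrib, h1, Finset.sum_const, nsmul_eq_mul]
  have hx : 0 < 1 - ε := by linarith
  have h5 : ((L \ P.toFinset).card : ℝ) * ((1 - ε) ^ 2 * ρ) ≤ L.card * ((1 - ε) ^ 2 * ρ) :=
    mul_le_mul_of_nonneg_right h4 (by positivity)
  have h6 := mul_le_mul_of_nonneg_left hcost (show 0 ≤ (1 - ε) * ρ by positivity)
  have h7 := mul_le_mul_of_nonneg_left h3 hx.le
  nlinarith

/-- The gain of the batch telescopes. Whether position `i` belongs to the batch is decided by the
first `i` elements alone, as the form of `H` records; so the next element is still uniform among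
those not drawn. -/
lemma batch_gain_eq {l : List α} (hl : l ∈ orderings L) {s : ℕ} {t : ℕ × ℕ}
    (ht : t = (firstIndex (l.take s).length (costCond 𝓘 ρ ε f X (l.take s) L),
      firstIndex (l.take s).length (valueCond 𝓘 ρ ε f X (l.take s) L))) (q : ℝ)
    {H : List α → α → ℝ}
    (hH : ∀ P v, H P v = open Classical in
      if P.length < s ∧ NotStopped 𝓘 ρ ε f X L P then gain f (X ∪ P.toFinset) v - q else 0) :
    f (X ∪ batch (l.take s) t) - f X - (batch (l.take s) t).card * q =
      ∑ i ∈ range L.card, l[i]?.elim 0 (H (l.take i)) := by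
  have hlen := length_of_mem_orderings hl
  set V := l.take s with hV
  -- If neither index is found, both equal `d + 1` and the batch is the whole sequence, of length
  -- `d`.
  set τ := min (min t.1 t.2) V.length with hτ
  have hVlen : V.length = min s L.card := by rw [hV, List.length_take, hlen]
  have hW : batch V t = (V.take τ).toFinset := by
    rw [batch, hτ]
    congr 1
    rw [List.take_eq_take_iff]
    omega
  have hWcard : (batch V t).card = τ := by
    rw [hW, List.toFinset_card_of_nodup, List.length_take]
    · omega
    · exact ((mem_orderings.mp hl).1.take).take
  have hterm : ∀ i ∈ range L.card, l[i]?.elim 0 (H (l.take i)) =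
      if i < τ then f (prefixSet X V (i + 1)) - f (prefixSet X V i) - q else 0 := by
    intro i hi
    rw [Finset.mem_range] at hi
    have hil : i < l.length := by omega
    have hlt : (l.take i).length = i := by rw [List.length_take]; omega
    rw [List.getElem?_eq_getElem hil, Option.elim_some, hH, hlt]
    have hiff : (i < s ∧ NotStopped 𝓘 ρ ε f X L (l.take i)) ↔ i < τ := by
      constructor
      · rintro ⟨h1, h2⟩
        have h3 : i < V.length := by omega
        have m1 := firstIndex_mem V.length (costCond 𝓘 ρ ε f X V L)
        have m2 := firstIndex_mem V.length (valueCond 𝓘 ρ ε f X V L)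
        refine lt_min (lt_min ?_ ?_) h3
        · by_contra h4
          rw [not_lt, ht] at h4
          simp only at h4
          refine (h2 _ m1.1 (by rw [hlt]; exact h4)).1 ?_
          rw [costCond_take l h4, ← costCond_take (i := s) l (by omega)]
          exact m1.2.resolve_right (by omega)
        · by_contra h4
          rw [not_lt, ht] at h4
          simp only at h4
          refine (h2 _ m2.1 (by rw [hlt]; exact h4)).2 ?_
          rw [valueCond_take l h4, ← valueCond_take (i := s) l (by omega)]
          exact m2.2.resolve_right (by omega)
      · intro h
        refine ⟨by omega, fun j hj1 hj2 => ?_⟩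
        rw [hlt] at hj2
        rw [costCond_take l hj2, valueCond_take l hj2, ← costCond_take (i := s) l (by omega),
          ← valueCond_take (i := s) l (by omega)]
        have e1 : j < t.1 := by omega
        have e2 : j < t.2 := by omega
        rw [ht] at e1 e2
        exact ⟨not_of_lt_firstIndex hj1 e1, not_of_lt_firstIndex hj1 e2⟩
    simp only [hiff]
    split_ifs with h
    · have h1 : X ∪ (l.take i).toFinset = prefixSet X V i := by
        rw [hV, prefixSet_take l (by omega)]
        rfl
      have h2 : l[i] = V[i]'(by omega) := by simp [hV]
      rw [prefixSet_succ (by omega), h1, gain, h2]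
    · rfl
  rw [Finset.sum_congr rfl hterm, ← Finset.sum_filter]
  have hfil : (range L.card).filter (fun i => i < τ) = range τ := by
    ext i
    simp only [Finset.mem_filter, Finset.mem_range]
    omega
  rw [hfil, Finset.sum_sub_distrib, Finset.sum_range_sub (fun i => f (prefixSet X V i)),
    Finset.sum_const, Finset.card_range, nsmul_eq_mul, hWcard, hW]
  simp [prefixSet]

/-- In expectation, each element of a batch contributes at least `(1 - ε)² ρ`. -/
lemma sum_batch_gain_nonneg (hρ : 0 < ρ) (hε0 : 0 < ε) (hε1 : ε < 1)
    (hL : ∀ u ∈ L, ρ ≤ gain f X u ∧ insert u X ∈ 𝓘) (s : ℕ) {t : List α → ℕ × ℕ}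
    (ht : ∀ l, t l = (firstIndex (l.take s).length (costCond 𝓘 ρ ε f X (l.take s) L),
      firstIndex (l.take s).length (valueCond 𝓘 ρ ε f X (l.take s) L))) :
    0 ≤ ∑ l ∈ orderings L, (f (X ∪ batch (l.take s) (t l)) - f X -
      (batch (l.take s) (t l)).card * ((1 - ε) ^ 2 * ρ)) := by
  classical
  let H : List α → α → ℝ := fun P v =>
    if P.length < s ∧ NotStopped 𝓘 ρ ε f X L P then
      gain f (X ∪ P.toFinset) v - (1 - ε) ^ 2 * ρ else 0
  rw [Finset.sum_congr rfl fun l hl => batch_gain_eq hl (ht l) ((1 - ε) ^ 2 * ρ) (H := H)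
    fun P v => by simp only [H], Finset.sum_comm]
  refine Finset.sum_nonneg fun i _ => sum_orderings_getElem_nonneg L H i fun P _ _ => ?_
  by_cases h : P.length < s ∧ NotStopped 𝓘 ρ ε f X L P
  · simp only [H, if_pos h]
    exact sum_gain_nonneg hρ hε0 hε1 hL h.2
  · simp only [H, if_neg h]
    simp

end BatchGain

/-! ### The value of the elements that are discarded by `RandBatch` -/

section BatchInv

variable {α : Type u} [DecidableEq α] {f : Finset α → ℝ} {𝓘 : Finset (Finset α)} {ρ ε : ℝ}
  {T I A U L O : Finset α} {r count : ℕ}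

lemma IsSubmodular.union_sub_le (hf : IsSubmodular f) (X : Finset α) {W N : Finset α}
    (h : Disjoint W N) : f (X ∪ W ∪ N) - f (X ∪ N) ≤ f (X ∪ W) - f X := by
  have h1 := hf (X ∪ W) (X ∪ N)
  have h2 : X ∪ W ∪ (X ∪ N) = X ∪ W ∪ N := by
    ext x
    simp only [Finset.mem_union]
    tauto
  rw [h2, ← Finset.union_inter_distrib_left, Finset.disjoint_iff_inter_eq_empty.mp h,
    Finset.union_empty] at h1
  linarith

/-- Dropping the elements with negative gains from the first `i` elements of a sequence yields a
set whose value accounts for all the positive gains. -/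
lemma IsSubmodular.exists_drop_negative (hf : IsSubmodular f) {X P : Finset α} (hP : P ⊆ X)
    (V : List α) (i : ℕ) (hi : i ≤ V.length) :
    ∃ P' ⊆ prefixSet X V i,
      f P + (f (prefixSet X V i) - f X) + dropSum f X V i ≤ f P' := by
  induction i with
  | zero => exact ⟨P, by simpa [prefixSet] using hP, by simp [prefixSet, dropSum]⟩
  | succ i ih =>
    obtain ⟨P', hP', h⟩ := ih (by omega)
    rw [dropSum_eq] at h ⊢
    rw [Finset.sum_range_succ]
    have hsub := prefixSet_mono X V (Nat.le_succ i)
    rcases le_total (f (prefixSet X V (i + 1))) (f (prefixSet X V i)) with hle | hle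
    · refine ⟨P', hP'.trans hsub, ?_⟩
      rw [max_eq_left (by linarith)]
      linarith
    · rw [max_eq_right (by linarith)]
      have hs := prefixSet_succ (X := X) (V := V) (i := i) (by omega)
      by_cases hv : V[i] ∈ prefixSet X V i
      · rw [Finset.insert_eq_of_mem hv] at hs
        exact ⟨P', hP'.trans hsub, by rw [hs]; linarith⟩
      · refine ⟨insert V[i] P', ?_, ?_⟩
        · rw [hs]
          exact Finset.insert_subset_insert _ hP'
        · have := hf.gain_le hP' hv
          rw [gain, gain, ← hs] at this
          linarith

/-- The invariant of the loop of `RandBatch` that the approximation guarantee is based on. The last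
field bounds the value of the current candidates. -/
structure BatchInv (f : Finset α → ℝ) (𝓘 : Finset (Finset α)) (r : ℕ) (ρ ε : ℝ)
    (T I A U L : Finset α) (count : ℕ) : Prop extends LoopInv 𝓘 r T A U L where
  subset_left : U ⊆ I
  subset_right : L ⊆ I
  disjoint' : Disjoint U L
  value : ∀ u ∈ L, ρ ≤ gain f (T ∪ A) u
  rest : (T ∪ A).card = r ∨ ∀ u ∈ I \ (U ∪ L), gain f (T ∪ A) u ≤ ρ
  lost : ∃ P N : Finset α, P ⊆ T ∪ A ∧ Disjoint N L ∧
    f (T ∪ A ∪ N) + count * (ε * ∑ u ∈ L, gain f (T ∪ A) u) ≤ f P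

/-- The total gain of the candidates never increases, so contributions to `lost` from earlier
counted batches stay valid with the current sum. -/
lemma BatchInv.sum_gain_le (hρ : 0 ≤ ρ) (h : BatchInv f 𝓘 r ρ ε T I A U L count)
    (hf : IsSubmodular f) {G L' : Finset α} (hG : T ∪ A ⊆ G) (hL' : L' ⊆ L)
    (hd : Disjoint G L') : ∑ u ∈ L', gain f G u ≤ ∑ u ∈ L, gain f (T ∪ A) u := by
  refine (Finset.sum_le_sum fun u hu => hf.gain_le hG
    fun h' => Finset.disjoint_left.mp hd h' hu).trans ?_
  exact Finset.sum_le_sum_of_subset_of_nonneg hL' fun u hu _ => hρ.trans (h.value u hu)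

/-- Unless the solution is full, a candidate that leaves `L` without entering `U` can only have
failed the gain test, and later gains are smaller. -/
lemma BatchInv.rest_next (h𝓘 : ∀ Y, Y ∈ 𝓘 ↔ Y.card ≤ r)
    (h : BatchInv f 𝓘 r ρ ε T I A U L count) (hf : IsSubmodular f) (hTI : Disjoint T I)
    (hL : L ≠ ∅) {A' W : Finset α} (hA : A ⊆ A')
    (hnext : LoopInv 𝓘 r T A' (U ∪ W) (valuable 𝓘 ρ f (T ∪ A') (L \ (U ∪ W)))) :
    (T ∪ A').card = r ∨
      ∀ u ∈ I \ (U ∪ W ∪ valuable 𝓘 ρ f (T ∪ A') (L \ (U ∪ W))), gain f (T ∪ A') u ≤ ρ := by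
  refine or_iff_not_imp_left.mpr fun hfull u hu => ?_
  have hlt := lt_of_le_of_ne hnext.card_le hfull
  rw [Finset.mem_sdiff, Finset.mem_union, not_or] at hu
  obtain ⟨huI, huU, huL⟩ := hu
  have huT : u ∉ T ∪ A' := by
    rw [Finset.mem_union, not_or]
    exact ⟨fun h1 => Finset.disjoint_left.mp hTI h1 huI, fun h1 => huU (hnext.subset h1)⟩
  by_cases hLu : u ∈ L
  · by_contra hgt
    refine huL (mem_valuable.mpr ⟨Finset.mem_sdiff.mpr ⟨hLu, huU⟩, (not_le.mp hgt).le, ?_⟩)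
    rw [h𝓘, Finset.card_insert_of_notMem huT]
    exact hlt
  · have hrest := h.rest.resolve_left (h.toLoopInv.card_lt h𝓘 hL).ne
    refine (hf.gain_le (Finset.union_subset_union_right hA) huT).trans (hrest u ?_)
    rw [Finset.mem_union, not_or] at huU
    simp [huI, huU.1, hLu]

lemma BatchInv.reject (hρ : 0 ≤ ρ) (hε : 0 ≤ ε) (h𝓘 : ∀ Y, Y ∈ 𝓘 ↔ Y.card ≤ r)
    (h : BatchInv f 𝓘 r ρ ε T I A U L count) (hf : IsSubmodular f) (hTI : Disjoint T I)
    (hL : L ≠ ∅) {W : Finset α} (hW : W ⊆ L) :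
    BatchInv f 𝓘 r ρ ε T I A (U ∪ W) (valuable 𝓘 ρ f (T ∪ A) (L \ (U ∪ W))) count where
  toLoopInv := h.toLoopInv.reject W
  subset_left := Finset.union_subset h.subset_left (hW.trans h.subset_right)
  subset_right := (valuable_subset _).trans (Finset.sdiff_subset.trans h.subset_right)
  disjoint' := Finset.disjoint_sdiff.mono_right (valuable_subset _)
  value _ hu := (mem_valuable.mp hu).2.1
  rest := h.rest_next h𝓘 hf hTI hL subset_rfl (h.toLoopInv.reject W)
  lost := by
    obtain ⟨P, N, h1, h2, h3⟩ := h.lost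
    have hsub : valuable 𝓘 ρ f (T ∪ A) (L \ (U ∪ W)) ⊆ L :=
      (valuable_subset _).trans Finset.sdiff_subset
    refine ⟨P, N, h1, h2.mono_right hsub, le_trans ?_ h3⟩
    have := h.sum_gain_le hρ hf subset_rfl hsub (h.disjoint.mono_right hsub)
    gcongr

/-- The field `lost` compares a subset `P` of the solution with the solution enlarged by harmful
elements `N`. Accepting `W` moves `P` up by the gain of `W` plus the drops, but the enlarged set by
at most the gain of `W`. For a counted batch, `valueCond` makes the drops and the negative gains
together at least `ε` times the total gain of the valuable elements. -/
lemma BatchInv.accept (hρ : 0 < ρ) (hε : 0 ≤ ε) (h𝓘 : ∀ Y, Y ∈ 𝓘 ↔ Y.card ≤ r)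
    (h : BatchInv f 𝓘 r ρ ε T I A U L count) (hf : IsSubmodular f) (hTI : Disjoint T I)
    (hL : L ≠ ∅) {V : List α} {t : ℕ × ℕ} (hW : batch V t ⊆ L)
    (hcard : (T ∪ A ∪ batch V t).card ≤ r)
    (ht1 : t.1 ≤ V.length + 1) (ht2 : valueCond 𝓘 ρ ε f (T ∪ A) V L t.2 ∨ t.2 = V.length + 1) :
    BatchInv f 𝓘 r ρ ε T I (A ∪ batch V t) (U ∪ batch V t)
      (valuable 𝓘 ρ f (T ∪ (A ∪ batch V t)) (L \ (U ∪ batch V t)))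
      (if t.2 < t.1 then count + 1 else count) where
  toLoopInv := h.toLoopInv.accept hcard
  subset_left := Finset.union_subset h.subset_left (hW.trans h.subset_right)
  subset_right := (valuable_subset _).trans (Finset.sdiff_subset.trans h.subset_right)
  disjoint' := Finset.disjoint_sdiff.mono_right (valuable_subset _)
  value _ hu := (mem_valuable.mp hu).2.1
  rest := h.rest_next h𝓘 hf hTI hL Finset.subset_union_left (h.toLoopInv.accept hcard)
  lost := by
    obtain ⟨P, N, h1, h2, h3⟩ := h.lost
    set L' := valuable 𝓘 ρ f (T ∪ (A ∪ batch V t)) (L \ (U ∪ batch V t)) with hL'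
    have hsub : L' ⊆ L := (valuable_subset _).trans Finset.sdiff_subset
    have hdisj := (h.toLoopInv.accept (ρ := ρ) (f := f) hcard).disjoint
    rw [← hL'] at hdisj
    set τ := min (min t.1 t.2) V.length with hτ
    have hG : T ∪ (A ∪ batch V t) = prefixSet (T ∪ A) V τ := by
      rw [← Finset.union_assoc, batch, prefixSet]
      congr 2
      rw [List.take_eq_take_iff]
      omega
    have hdropnn : 0 ≤ dropSum f (T ∪ A) V τ := by
      rw [dropSum_eq]
      exact Finset.sum_nonneg fun _ _ => le_max_right _ _
    obtain ⟨P', hP', hfP'⟩ := hf.exists_drop_negative h1 V τ (min_le_right _ _)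
    rw [← hG] at hP' hfP'
    have hsum := h.sum_gain_le hρ.le hf (Finset.union_subset_union_right
      (Finset.subset_union_left (s₁ := A) (s₂ := batch V t))) hsub hdisj
    have hmul : (count : ℝ) * (ε * ∑ u ∈ L', gain f (T ∪ (A ∪ batch V t)) u) ≤
        count * (ε * ∑ u ∈ L, gain f (T ∪ A) u) := by gcongr
    have hN := hf.union_sub_le (T ∪ A) (h2.mono_right hW).symm
    rw [Finset.union_assoc T A] at hN
    split_ifs with hlt
    · have hτ2 : τ = t.2 := by omega
      have hval := ht2.resolve_right (by omega)
      rw [← hτ2, valueCond, ← hG] at hval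
      -- Adjoining `E` lowers the value by the total of its negative gains. `E` misses the new
      -- candidates, whose gains are at least `ρ > 0`.
      set E := negative f (T ∪ (A ∪ batch V t)) L with hE
      refine ⟨P', N ∪ E, hP', ?_, ?_⟩
      · refine Finset.disjoint_union_left.mpr ⟨h2.mono_right hsub, ?_⟩
        rw [Finset.disjoint_left]
        intro u hu hu'
        have e1 := (Finset.mem_filter.mp hu).2
        have e2 := (mem_valuable.mp hu').2.1
        linarith
      · have hNE : Disjoint N E := h2.mono_right (Finset.filter_subset _ _)
        have e1 := hf.union_sub_le (T ∪ (A ∪ batch V t)) hNE.symm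
        have e2 := hf.union_le (T ∪ (A ∪ batch V t)) E
        have e3 : ∑ u ∈ E, |gain f (T ∪ (A ∪ batch V t)) u| =
            -∑ u ∈ E, gain f (T ∪ (A ∪ batch V t)) u := by
          rw [← Finset.sum_neg_distrib]
          exact Finset.sum_congr rfl fun u hu => abs_of_neg (Finset.mem_filter.mp hu).2
        rw [e3] at hval
        have e4 : ∑ u ∈ L', gain f (T ∪ (A ∪ batch V t)) u ≤
            ∑ u ∈ valuable 𝓘 ρ f (T ∪ (A ∪ batch V t)) L, gain f (T ∪ (A ∪ batch V t)) u := by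
          refine Finset.sum_le_sum_of_subset_of_nonneg
            (Finset.filter_subset_filter _ Finset.sdiff_subset) fun u hu _ => ?_
          exact hρ.le.trans (mem_valuable.mp hu).2.1
        have e5 := mul_le_mul_of_nonneg_left e4 hε
        rw [Finset.union_right_comm, Finset.union_assoc _ N E] at e1
        push_cast
        linarith
    · refine ⟨P', N, hP', h2.mono_right hsub, ?_⟩
      linarith

lemma BatchInv.initial (hT : T.card ≤ r) (hTI : Disjoint T I) (h𝓘 : ∀ Y, Y ∈ 𝓘 ↔ Y.card ≤ r) :
    BatchInv f 𝓘 r ρ ε T I ∅ ∅ (valuable 𝓘 ρ f T I) 0 where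
  toLoopInv := LoopInv.initial hT hTI
  subset_left := Finset.empty_subset _
  subset_right := valuable_subset _
  disjoint' := Finset.disjoint_empty_left _
  value u hu := by
    rw [Finset.union_empty]
    exact (mem_valuable.mp hu).2.1
  rest := by
    simp only [Finset.union_empty, Finset.empty_union]
    refine or_iff_not_imp_left.mpr fun hfull u hu => ?_
    rw [Finset.mem_sdiff] at hu
    by_contra hgt
    refine hu.2 (mem_valuable.mpr ⟨hu.1, (not_le.mp hgt).le, ?_⟩)
    rw [h𝓘, Finset.card_insert_of_notMem fun h1 => Finset.disjoint_left.mp hTI h1 hu.1]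
    exact lt_of_le_of_ne hT hfull
  lost := ⟨T, ∅, by simp, by simp, by simp⟩

end BatchInv

/-! ### The approximation guarantee -/

section Approximation

variable {α : Type u} [DecidableEq α] {f : Finset α → ℝ} {𝓘 : Finset (Finset α)} {ρ ε : ℝ}
  {T I A U L O : Finset α} {r M count : ℕ} {mode : SearchMode}

/-- The elements of `O` outside both the solution and the pool are the ones lost so far. Moving `W`
from the pool to the solution leaves this set unchanged, and their gains shrink. -/
lemma sum_gain_accept_le (hf : IsSubmodular f) {W : Finset α} (hWI : W ⊆ I \ U) :
    ∑ o ∈ O \ (T ∪ (A ∪ W) ∪ I \ (U ∪ W)), gain f (T ∪ (A ∪ W)) o ≤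
      ∑ o ∈ O \ (T ∪ A ∪ I \ U), gain f (T ∪ A) o := by
  have hS : O \ (T ∪ (A ∪ W) ∪ I \ (U ∪ W)) = O \ (T ∪ A ∪ I \ U) := by
    ext o
    have := @hWI o
    simp only [Finset.mem_sdiff, Finset.mem_union] at this ⊢
    tauto
  rw [← hS]
  refine Finset.sum_le_sum fun o ho => hf.gain_le
    (Finset.union_subset_union_right Finset.subset_union_left) fun h => ?_
  exact (Finset.mem_sdiff.mp ho).2 (Finset.mem_union_left _ h)

lemma card_accept_mul_le {W : Finset α} {q : ℝ} (hq : 0 ≤ q) :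
    ((T ∪ (A ∪ W)) \ O).card * q ≤ ((T ∪ A) \ O).card * q + (W \ O).card * q := by
  rw [← Finset.union_assoc, Finset.union_sdiff_distrib, ← add_mul]
  exact mul_le_mul_of_nonneg_right (by exact_mod_cast Finset.card_union_le _ _) hq

lemma sum_gain_reject_le (hf : IsSubmodular f) {W : Finset α} {q : ℝ} (hq : 0 ≤ q)
    (hcap : ∀ u ∈ I, gain f T u ≤ q) (hd : Disjoint (T ∪ A) L) (hLI : L ⊆ I) (hW : W ⊆ L) :
    ∑ o ∈ O \ (T ∪ A ∪ I \ (U ∪ W)), gain f (T ∪ A) o ≤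
      ∑ o ∈ O \ (T ∪ A ∪ I \ U), gain f (T ∪ A) o + (W ∩ O).card * q := by
  have hS : O \ (T ∪ A ∪ I \ U) ⊆ O \ (T ∪ A ∪ I \ (U ∪ W)) := by
    intro o
    simp only [Finset.mem_sdiff, Finset.mem_union]
    tauto
  have hS' : (O \ (T ∪ A ∪ I \ (U ∪ W))) \ (O \ (T ∪ A ∪ I \ U)) ⊆ W ∩ O := by
    intro o
    simp only [Finset.mem_sdiff, Finset.mem_union, Finset.mem_inter]
    tauto
  rw [← Finset.sum_sdiff hS, add_comm]
  refine add_le_add le_rfl ((Finset.sum_le_card_nsmul _ _ q fun o ho => ?_).trans ?_)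
  · have ho' := (Finset.mem_inter.mp (hS' ho)).1
    exact (hf.gain_le Finset.subset_union_left fun h' =>
      Finset.disjoint_left.mp hd h' (hW ho')).trans (hcap o (hLI (hW ho')))
  · rw [nsmul_eq_mul]
    exact mul_le_mul_of_nonneg_right (by exact_mod_cast Finset.card_le_card hS') hq

/-- The loss when `L` is thrown away at the end of a call of `RandBatch`. -/
lemma sum_gain_discard_le (hL : ∀ u ∈ L, 0 ≤ gain f (T ∪ A) u) :
    ∑ o ∈ O \ (T ∪ A ∪ I \ (U ∪ L)), gain f (T ∪ A) o ≤
      ∑ o ∈ O \ (T ∪ A ∪ I \ U), gain f (T ∪ A) o + ∑ u ∈ L, gain f (T ∪ A) u := by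
  have hS : O \ (T ∪ A ∪ I \ U) ⊆ O \ (T ∪ A ∪ I \ (U ∪ L)) := by
    intro o
    simp only [Finset.mem_sdiff, Finset.mem_union]
    tauto
  rw [← Finset.sum_sdiff hS, add_comm]
  refine add_le_add le_rfl
    (Finset.sum_le_sum_of_subset_of_nonneg ?_ fun u hu _ => hL u hu)
  intro o
  simp only [Finset.mem_sdiff, Finset.mem_union]
  tauto

/-- `K` stands for the rest of the run. The account `a` covers the elements of `O` lost so far, and
`b` is the reserve earned by solution elements outside `O`. An accepted batch adds `|W \ O| ρ/(1-ε)`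
to `b`, a rejected one `|W ∩ O| ρ/(1-ε)` to `a`; averaged over coin and ordering, the increase of
the first term pays for both. The term `opt / (ε * M)` pays once, if the call ends with candidates
left. -/
lemma le_mean_randBatchLoop (hf : IsSubmodular f) (hf0 : ∀ X, 0 ≤ f X)
    (h𝓘 : ∀ Y, Y ∈ 𝓘 ↔ Y.card ≤ r) (hρ : 0 < ρ) (hε0 : 0 < ε) (hε1 : ε < 1) (hM : 0 < M)
    {opt : ℝ} (hopt : ∀ P : Finset α, P.card ≤ r → f P ≤ opt) (hTI : Disjoint T I)
    (hcap : ∀ u ∈ I, gain f T u ≤ ρ / (1 - ε)) (K : Finset α × Finset α × Finset α → ℝ) (δ : ℝ)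
    (hK : ∀ (A U L : Finset α) (a b : ℝ), LoopInv 𝓘 r T A U L → U ⊆ I →
      ∑ o ∈ O \ (T ∪ A ∪ I \ (U ∪ L)), gain f (T ∪ A) o ≤ a →
      ((T ∪ A) \ O).card * (ρ / (1 - ε)) ≤ b →
      ((T ∪ A).card = r ∨ ∀ u ∈ I \ (U ∪ L), gain f (T ∪ A) u ≤ ρ) →
      ((1 - ε) ^ 3)⁻¹ * f (T ∪ A) - a - b - δ ≤ K (A, U, L))
    (k : ℕ) (a b : ℝ) (h : BatchInv f 𝓘 r ρ ε T I A U L count) (hk : L.card ≤ k)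
    (ha : ∑ o ∈ O \ (T ∪ A ∪ I \ U), gain f (T ∪ A) o ≤ a)
    (hb : ((T ∪ A) \ O).card * (ρ / (1 - ε)) ≤ b) :
    ((1 - ε) ^ 3)⁻¹ * f (T ∪ A) - a - b - (δ + opt / (ε * M)) ≤
      mean f (randBatchLoop mode 𝓘 ρ ε oneHalf M T k A U L count) K := by
  have hx : 0 < 1 - ε := by linarith
  have hc : 0 < ρ / (1 - ε) := div_pos hρ hx
  have hopt0 : 0 ≤ opt := (hf0 ∅).trans (hopt ∅ (by simp))
  have hM' : (0 : ℝ) < M := by exact_mod_cast hM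
  have hloss : 0 ≤ opt / (ε * M) := by positivity
  induction k generalizing A U L count a b with
  | zero =>
    have hL : L = ∅ := Finset.card_eq_zero.mp (Nat.le_zero.mp hk)
    subst hL
    have := hK A U ∅ a b h.toLoopInv h.subset_left (by simpa using ha) hb h.rest
    rw [randBatchLoop, mean]
    linarith
  | succ k ih =>
    by_cases h0 : L = ∅ ∨ M ≤ count
    · rw [randBatchLoop, if_pos h0, mean]
      rcases h0 with rfl | hMc
      · have := hK A U ∅ a b h.toLoopInv h.subset_left (by simpa using ha) hb h.rest
        linarith
      -- `lost` with `count ≥ M`: the gap is at most `opt`, since `f P ≤ opt` and the other value is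
      -- nonnegative.
      · have hsum : ∑ u ∈ L, gain f (T ∪ A) u ≤ opt / (ε * M) := by
          obtain ⟨P, N, h1, h2, h3⟩ := h.lost
          have e1 := hopt P ((Finset.card_le_card h1).trans h.card_le)
          have e2 := hf0 (T ∪ A ∪ N)
          have e3 : 0 ≤ ∑ u ∈ L, gain f (T ∪ A) u :=
            Finset.sum_nonneg fun u hu => hρ.le.trans (h.value u hu)
          have e4 : (M : ℝ) ≤ count := by exact_mod_cast hMc
          have e5 := mul_le_mul_of_nonneg_right e4 (mul_nonneg hε0.le e3)
          rw [le_div_iff₀ (by positivity)]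
          linarith
        have hgone := (sum_gain_discard_le (I := I) (U := U) (O := O) fun u hu =>
          hρ.le.trans (h.value u hu)).trans (add_le_add ha hsum)
        have := hK A U L _ b h.toLoopInv h.subset_left hgone hb h.rest
        linarith
    · rw [not_or, not_le] at h0
      rw [mean_randBatchLoop_succ h𝓘 h.toLoopInv h0.1 h0.2]
      simp only [mean_findIndices hf h𝓘 hρ hε0.le]
      set s := r - (T ∪ A).card with hs
      set t : List α → ℕ × ℕ := fun l =>
        (firstIndex (l.take s).length (costCond 𝓘 ρ ε f (T ∪ A) (l.take s) L),
          firstIndex (l.take s).length (valueCond 𝓘 ρ ε f (T ∪ A) (l.take s) L)) with ht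
      have hgain := sum_batch_gain_nonneg (𝓘 := 𝓘) hρ hε0 hε1
        (fun u hu => ⟨h.value u hu, h.feasible u hu⟩) s (t := t) (fun l => rfl)
      rw [le_div_iff₀ (orderings_card_pos L)]
      set base := ((1 - ε) ^ 3)⁻¹ * f (T ∪ A) - a - b - (δ + opt / (ε * M)) with hbase
      have hstep : ∀ l ∈ orderings L, base + 1 / 2 * (((1 - ε) ^ 3)⁻¹ *
          (f (T ∪ A ∪ batch (l.take s) (t l)) - f (T ∪ A) -
            (batch (l.take s) (t l)).card * ((1 - ε) ^ 2 * ρ))) ≤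
          1 / 2 * mean f (randBatchLoop mode 𝓘 ρ ε oneHalf M T k
            (A ∪ batch (l.take s) (t l)) (U ∪ batch (l.take s) (t l))
            (valuable 𝓘 ρ f (T ∪ (A ∪ batch (l.take s) (t l)))
              (L \ (U ∪ batch (l.take s) (t l))))
            (if (t l).2 < (t l).1 then count + 1 else count)) K +
          1 / 2 * mean f (randBatchLoop mode 𝓘 ρ ε oneHalf M T k
            A (U ∪ batch (l.take s) (t l))
            (valuable 𝓘 ρ f (T ∪ A) (L \ (U ∪ batch (l.take s) (t l)))) count) K := by
        intro l hl
        have m1 := firstIndex_mem (l.take s).length (costCond 𝓘 ρ ε f (T ∪ A) (l.take s) L)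
        have m2 := firstIndex_mem (l.take s).length (valueCond 𝓘 ρ ε f (T ∪ A) (l.take s) L)
        have m3 := firstIndex_le (l.take s).length (costCond 𝓘 ρ ε f (T ∪ A) (l.take s) L)
        have m4 := firstIndex_le (l.take s).length (valueCond 𝓘 ρ ε f (T ∪ A) (l.take s) L)
        have hne := batch_nonempty h𝓘 h.toLoopInv h0.1 hl (t := t l) m1.1 m2.1
        have hWL := batch_subset hl s (t l)
        have hcard := card_union_batch_le hl h.card_le (t l)
        rw [← hs] at hne hcard
        have hacc := h.accept hρ hε0.le h𝓘 hf hTI h0.1 hWL hcard m3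
          (m2.2.imp_right fun h => by simp only [ht]; omega)
        have hrej := h.reject hρ.le hε0.le h𝓘 hf hTI h0.1 hWL
        set W := batch (l.take s) (t l) with hW
        have hLk : ∀ X, (valuable 𝓘 ρ f X (L \ (U ∪ W))).card ≤ k := by
          intro X
          have e1 : (L \ (U ∪ W)).card ≤ (L \ W).card :=
            Finset.card_le_card (Finset.sdiff_subset_sdiff subset_rfl Finset.subset_union_right)
          have e2 := Finset.card_le_card (valuable_subset (𝓘 := 𝓘) (ρ := ρ) (f := f)
            (L := L \ (U ∪ W)) X)
          have e3 := Finset.card_sdiff_of_subset hWL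
          have e4 := hne.card_pos
          omega
        have hWI : W ⊆ I \ U := fun u hu => Finset.mem_sdiff.mpr
          ⟨h.subset_right (hWL hu), fun h' => Finset.disjoint_left.mp h.disjoint' h' (hWL hu)⟩
        have r1 := ih a (b + (W \ O).card * (ρ / (1 - ε))) hacc (hLk _)
          ((sum_gain_accept_le hf hWI).trans ha)
          ((card_accept_mul_le hc.le).trans (add_le_add hb le_rfl))
        have r2 := ih (a + (W ∩ O).card * (ρ / (1 - ε))) b hrej (hLk _)
          ((sum_gain_reject_le hf hc.le hcap h.disjoint h.subset_right hWL).trans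
            (add_le_add ha le_rfl)) hb
        have hcardW : ((W \ O).card : ℝ) + (W ∩ O).card = W.card := by
          exact_mod_cast Finset.card_sdiff_add_card_inter W O
        -- This balance between gain and charge per element determines the exponent 3.
        have hconst : ((1 - ε) ^ 3)⁻¹ * ((1 - ε) ^ 2 * ρ) = ρ / (1 - ε) := by
          field_simp
        have hexp : ((1 - ε) ^ 3)⁻¹ * (f (T ∪ A ∪ W) - f (T ∪ A) -
            W.card * ((1 - ε) ^ 2 * ρ)) = ((1 - ε) ^ 3)⁻¹ * f (T ∪ A ∪ W) -
            ((1 - ε) ^ 3)⁻¹ * f (T ∪ A) -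
            (((W \ O).card : ℝ) + (W ∩ O).card) * (ρ / (1 - ε)) := by
          rw [hcardW, ← hconst]
          ring
        rw [hexp, hbase]
        rw [← Finset.union_assoc] at r1
        rw [← Finset.union_assoc T A W]
        linarith
      refine le_trans ?_ (Finset.sum_le_sum hstep)
      rw [Finset.sum_add_distrib, ← Finset.mul_sum, ← Finset.mul_sum, Finset.sum_const,
        nsmul_eq_mul, mul_comm]
      have : 0 ≤ ((1 - ε) ^ 3)⁻¹ * ∑ l ∈ orderings L, (f (T ∪ A ∪ batch (l.take s) (t l)) -
          f (T ∪ A) - (batch (l.take s) (t l)).card * ((1 - ε) ^ 2 * ρ)) :=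
        mul_nonneg (by positivity) hgain
      linarith

end Approximation

/-! ### The loop over the thresholds. -/

section Outer

variable {α : Type u} [DecidableEq α] {f : Finset α → ℝ} {𝓘 : Finset (Finset α)} {ρ ε : ℝ}
  {T I A U L O : Finset α} {r M count : ℕ} {mode : SearchMode}

/-- Covers a full solution, and the degenerate case in which every singleton has value 0. -/
lemma mean_parSSPLoop_of_not_valuable {ρmax : ℝ} (k j : ℕ)
    (h : ∀ j, ∀ u ∈ I, ¬ (ρmax * (1 - ε) ^ j ≤ gain f T u ∧ insert u T ∈ 𝓘))
    (φ : Finset α → ℝ) :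
    mean f (parSSPLoop mode 𝓘 ρmax ε oneHalf M k j T I) φ = φ T := by
  induction k generalizing j with
  | zero => rfl
  | succ k ih =>
    have hv : valuable 𝓘 (ρmax * (1 - ε) ^ j) f T I = ∅ := by
      rw [valuable, Finset.filter_eq_empty_iff]
      exact fun u hu => h j u hu
    have hl : ∀ m, randBatchLoop mode 𝓘 (ρmax * (1 - ε) ^ j) ε oneHalf M T m ∅ ∅ ∅ 0 =
        .ret (∅, ∅, ∅) := by
      intro m
      cases m <;> simp [randBatchLoop]
    rw [parSSPLoop, mean_bind, randBatch, mean_bind, mean_queryValuable, hv, hl, mean]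
    simpa using ih (j + 1)

lemma IsSubmodular.union_sub_le_sum (hf : IsSubmodular f) (O T I : Finset α) :
    f (O ∪ T) - f T ≤ ∑ o ∈ O \ (T ∪ I), gain f T o + ∑ o ∈ O ∩ I, gain f T o := by
  have h1 := hf.union_le T O
  rw [Finset.union_comm T O, ← Finset.sum_inter_add_sum_sdiff O (T ∪ I)] at h1
  have h2 : ∑ o ∈ O ∩ (T ∪ I), gain f T o = ∑ o ∈ O ∩ I, gain f T o := by
    symm
    refine Finset.sum_subset (Finset.inter_subset_inter_left Finset.subset_union_right) ?_
    intro o ho ho'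
    simp only [Finset.mem_inter, Finset.mem_union] at ho ho'
    exact gain_of_mem (by tauto)
  linarith

/-- As `|O| ≤ |G|`, there are at least as many elements of `G` outside `O` as of `O` outside `G`. So
the reserve of a full solution covers every element of `O` still in the pool. -/
lemma card_inter_le_card_sdiff {G I' : Finset α} (hO : O.card ≤ r) (hG : G.card = r)
    (hd : Disjoint G I') : (O ∩ I').card ≤ (G \ O).card := by
  have h1 : (O ∩ I').card ≤ (O \ G).card := by
    refine Finset.card_le_card fun o ho => ?_
    rw [Finset.mem_inter] at ho
    exact Finset.mem_sdiff.mpr ⟨ho.1, fun h => Finset.disjoint_left.mp hd h ho.2⟩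
  have h2 := Finset.card_sdiff_add_card_inter O G
  have h3 := Finset.card_sdiff_add_card_inter G O
  rw [Finset.inter_comm] at h3
  omega

/-- At the end `f(O ∪ T) - f T` is at most the gains of the lost part of `O`, paid by `a`, plus
those of the part still in the pool. The latter is paid by `b` if the solution is full, and by `η`
otherwise, since at most `r` elements remain with gains at most the last threshold. The disjunction
`hb` records which case applies. -/
lemma le_mean_parSSPLoop (hf : IsSubmodular f) (hf0 : ∀ X, 0 ≤ f X)
    (h𝓘 : ∀ Y, Y ∈ 𝓘 ↔ Y.card ≤ r) (hε0 : 0 < ε) (hε1 : ε < 1) (hM : 0 < M)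
    {opt : ℝ} (hopt : ∀ P : Finset α, P.card ≤ r → f P ≤ opt) (hO : O.card ≤ r)
    {ρmax η : ℝ} (hρ : 0 < ρmax) (hη0 : 0 ≤ η) (k j : ℕ)
    (hη : r * (ρmax * (1 - ε) ^ (j + k) / (1 - ε)) ≤ η) (a b : ℝ) (hb0 : 0 ≤ b)
    (hT : T.card ≤ r) (hTI : Disjoint T I) (ha : ∑ o ∈ O \ (T ∪ I), gain f T o ≤ a)
    (hb : (∀ u ∈ I, gain f T u ≤ ρmax * (1 - ε) ^ j / (1 - ε)) ∧
        (T \ O).card * (ρmax * (1 - ε) ^ j / (1 - ε)) ≤ b ∨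
      T.card = r ∧ ∑ o ∈ O ∩ I, gain f T o ≤ b) :
    ((1 - ε) ^ 3)⁻¹ * f T - a - b - (η + k * (opt / (ε * M))) ≤
      mean f (parSSPLoop mode 𝓘 ρmax ε oneHalf M k j T I)
        fun S => ((1 - ε) ^ 3)⁻¹ * f S + f S - f (O ∪ S) := by
  have hx : 0 < 1 - ε := by linarith
  have hopt0 : 0 ≤ opt := (hf0 ∅).trans (hopt ∅ (by simp))
  have hloss : 0 ≤ opt / (ε * M) := by positivity
  have hsum := hf.union_sub_le_sum O T I
  induction k generalizing j T I a b with
  | zero =>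
    rw [parSSPLoop, mean]
    simp only [Nat.cast_zero, zero_mul, add_zero] at hη ⊢
    have : ∑ o ∈ O ∩ I, gain f T o ≤ b + η := by
      rcases hb with ⟨hcap, -⟩ | ⟨-, hb⟩
      · have e1 := Finset.sum_le_card_nsmul (O ∩ I) (gain f T) _
          fun o ho => hcap o (Finset.mem_inter.mp ho).2
        rw [nsmul_eq_mul] at e1
        have e2 : ((O ∩ I).card : ℝ) ≤ r := by
          exact_mod_cast (Finset.card_le_card Finset.inter_subset_left).trans hO
        have e3 := mul_le_mul_of_nonneg_right e2
          (show 0 ≤ ρmax * (1 - ε) ^ j / (1 - ε) by positivity)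
        linarith
      · linarith
    linarith
  | succ k ih =>
    rcases hb with ⟨hcap, hb⟩ | ⟨hfull, hb⟩
    · have hρj : 0 < ρmax * (1 - ε) ^ j := by positivity
      -- The cap on gains at the next threshold is the current threshold, which is what
      -- `BatchInv.rest` provides.
      have hnext : ρmax * (1 - ε) ^ (j + 1) / (1 - ε) = ρmax * (1 - ε) ^ j := by
        rw [pow_succ]
        field_simp
      rw [parSSPLoop, mean_bind, randBatch, mean_bind, mean_queryValuable]
      have hmain := le_mean_randBatchLoop (mode := mode) (O := O) hf hf0 h𝓘 hρj hε0 hε1 hM hopt hTI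
        hcap (fun R => mean f (parSSPLoop mode 𝓘 ρmax ε oneHalf M k (j + 1) (T ∪ R.1)
          (I \ (R.2.1 ∪ R.2.2))) fun S => ((1 - ε) ^ 3)⁻¹ * f S + f S - f (O ∪ S))
        (η + k * (opt / (ε * M))) ?_ I.card a b (BatchInv.initial hT hTI h𝓘)
        (Finset.card_le_card (valuable_subset _)) (by simpa using ha) (by simpa using hb)
      · rw [Finset.union_empty] at hmain
        refine le_trans (le_of_eq ?_) hmain
        push_cast
        ring
      · intro A U L a' b' hinv hUI ha' hb' hrest
        have hdis := hinv.disjoint_next hTI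
        have hcpos : 0 ≤ ρmax * (1 - ε) ^ j / (1 - ε) := by positivity
        have hb'0 : 0 ≤ b' := le_trans (by positivity) hb'
        refine ih (j + 1) (by rwa [add_right_comm, add_assoc]) a' b' hb'0 hinv.card_le hdis ha' ?_
          (hf.union_sub_le_sum _ _ _)
        rcases hrest with hfull | hrest
        -- The reserve is cashed in as soon as the solution is full; no later threshold changes
        -- anything.
        · refine Or.inr ⟨hfull, ?_⟩
          have e1 := Finset.sum_le_card_nsmul (O ∩ (I \ (U ∪ L))) (gain f (T ∪ A))
            (ρmax * (1 - ε) ^ j / (1 - ε)) fun o ho => by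
              have ho' := (Finset.mem_inter.mp ho).2
              exact (hf.gain_le Finset.subset_union_left fun h' =>
                Finset.disjoint_left.mp hdis h' ho').trans
                (hcap o (Finset.mem_sdiff.mp ho').1)
          rw [nsmul_eq_mul] at e1
          have e2 : ((O ∩ (I \ (U ∪ L))).card : ℝ) ≤ ((T ∪ A) \ O).card := by
            exact_mod_cast card_inter_le_card_sdiff hO hfull hdis
          have e3 := mul_le_mul_of_nonneg_right e2 hcpos
          linarith
        · refine Or.inl ⟨?_, ?_⟩
          · rw [hnext]
            exact hrest
          · rw [hnext]
            refine le_trans (mul_le_mul_of_nonneg_left ?_ (Nat.cast_nonneg _)) hb'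
            exact le_div_self hρj.le hx (by linarith)
    · rw [mean_parSSPLoop_of_not_valuable]
      · have : 0 ≤ ((k + 1 : ℕ) : ℝ) * (opt / (ε * M)) := by positivity
        linarith
      · rintro - u hu ⟨-, h2⟩
        rw [h𝓘, Finset.card_insert_of_notMem fun h' => Finset.disjoint_left.mp hTI h' hu] at h2
        omega

/-- An upper bound on the conditional probability that `u` is in the final solution. -/
lemma mean_randBatchLoop_mem_le (h𝓘 : ∀ Y, Y ∈ 𝓘 ↔ Y.card ≤ r) (u : α)
    (K : Finset α × Finset α × Finset α → ℝ)
    (hK : ∀ A U L : Finset α, LoopInv 𝓘 r T A U L →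
      K (A, U, L) ≤ if u ∈ T ∪ A then 1 else if u ∈ I \ U then 1 / 2 else 0)
    (k : ℕ) (h : LoopInv 𝓘 r T A U L) (hL : L ⊆ I \ U) :
    mean f (randBatchLoop mode 𝓘 ρ ε oneHalf M T k A U L count) K ≤
      if u ∈ T ∪ A then 1 else if u ∈ I \ U then 1 / 2 else 0 := by
  induction k generalizing A U L count with
  | zero => exact hK A U L h
  | succ k ih =>
    by_cases h0 : L = ∅ ∨ M ≤ count
    · rw [randBatchLoop, if_pos h0]
      exact hK A U L h
    rw [not_or, not_le] at h0
    rw [mean_randBatchLoop_succ h𝓘 h h0.1 h0.2, div_le_iff₀ (orderings_card_pos L), mul_comm,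
      ← nsmul_eq_mul]
    refine Finset.sum_le_card_nsmul _ _ _ fun l hl => ?_
    refine (mean_mono_of_le fun t => ?_).trans_eq (mean_const _ _)
    have hcard := card_union_batch_le hl h.card_le t
    have hWL := batch_subset hl (r - (T ∪ A).card) t
    set W := batch (l.take (r - (T ∪ A).card)) t
    have hsub : ∀ X, valuable 𝓘 ρ f X (L \ (U ∪ W)) ⊆ I \ (U ∪ W) := fun X =>
      (valuable_subset X).trans
        (Finset.sdiff_subset_sdiff (hL.trans Finset.sdiff_subset) subset_rfl)
    have r1 := ih (count := if t.2 < t.1 then count + 1 else count)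
      (h.accept (ρ := ρ) (f := f) hcard) (hsub _)
    have r2 := ih (count := count) (h.reject (ρ := ρ) (f := f) W) (hsub _)
    refine (add_le_add (mul_le_mul_of_nonneg_left r1 (by norm_num))
      (mul_le_mul_of_nonneg_left r2 (by norm_num))).trans ?_
    by_cases h1 : u ∈ T ∪ A
    · have h2 : u ∈ T ∪ (A ∪ W) := by
        rw [← Finset.union_assoc]
        exact Finset.mem_union_left _ h1
      simp only [if_pos h1, if_pos h2]
      norm_num
    -- An element of the batch is in the solution or excluded forever, each with probability 1/2:
    -- the mean of 1 and 0 is the prior bound 1/2.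
    · by_cases hW : u ∈ W
      · have h2 : u ∈ T ∪ (A ∪ W) := by simp [hW]
        have h3 : u ∉ I \ (U ∪ W) := by simp [hW]
        simp only [if_neg h1, if_pos h2, if_neg h3, if_pos (hL (hWL hW))]
        norm_num
      · have h2 : u ∉ T ∪ (A ∪ W) := by
          rw [← Finset.union_assoc, Finset.mem_union]
          tauto
        have h3 : (u ∈ I \ (U ∪ W)) ↔ u ∈ I \ U := by simp [hW]
        simp only [if_neg h1, if_neg h2, h3]
        split_ifs <;> norm_num

lemma mean_parSSPLoop_mem_le (h𝓘 : ∀ Y, Y ∈ 𝓘 ↔ Y.card ≤ r) (u : α) (ρmax : ℝ) (k j : ℕ)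
    (hT : T.card ≤ r) (hTI : Disjoint T I) :
    mean f (parSSPLoop mode 𝓘 ρmax ε oneHalf M k j T I) (fun S => if u ∈ S then 1 else 0) ≤
      if u ∈ T then 1 else if u ∈ I then 1 / 2 else 0 := by
  induction k generalizing j T I with
  | zero =>
    rw [parSSPLoop, mean]
    split_ifs <;> norm_num
  | succ k ih =>
    rw [parSSPLoop, mean_bind, randBatch, mean_bind, mean_queryValuable]
    have hmain := mean_randBatchLoop_mem_le (mode := mode) (f := f) (ρ := ρmax * (1 - ε) ^ j)
      (ε := ε) (M := M) (count := 0) (I := I) h𝓘 u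
      (fun R => mean f (parSSPLoop mode 𝓘 ρmax ε oneHalf M k (j + 1) (T ∪ R.1)
        (I \ (R.2.1 ∪ R.2.2))) fun S => if u ∈ S then 1 else 0) ?_ I.card
      (LoopInv.initial (f := f) (ρ := ρmax * (1 - ε) ^ j) hT hTI)
      (by rw [Finset.sdiff_empty]; exact valuable_subset _)
    · simpa using hmain
    · intro A U L hinv
      refine (ih (j + 1) hinv.card_le (hinv.disjoint_next hTI)).trans ?_
      simp only [Finset.mem_sdiff, Finset.mem_union]
      split_ifs <;> first | (norm_num; done) | (exfalso; tauto)

end Outer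

/-! ### The rank and the optimal value. -/

lemma argmax_spec {α : Type u} [Finite α] [Nonempty α] (h : α → ℝ) (u : α) : h u ≤ h (argmax h) :=
  Classical.choose_spec (Finite.exists_max h) u

lemma mem_cardFamily_iff {α : Type u} [Fintype α] [DecidableEq α] {B : ℝ} (hB : 1 ≤ B) (X : Finset α) :
    X ∈ cardFamily α B ↔ X.card ≤ rank (cardFamily α B) := by
  constructor
  · exact fun h => Finset.le_sup (f := Finset.card) h
  · intro h
    have hne : (cardFamily α B).Nonempty := ⟨∅, by simp [cardFamily]; linarith⟩
    obtain ⟨Y, hY, hY'⟩ := Finset.exists_mem_eq_sup _ hne Finset.card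
    have h1 : (Y.card : ℝ) ≤ B := by simpa [cardFamily] using hY
    rw [rank, hY'] at h
    have h2 : (X.card : ℝ) ≤ Y.card := by exact_mod_cast h
    simp only [cardFamily, Finset.mem_filter, Finset.mem_univ, true_and]
    linarith

lemma rank_le_card {α : Type u} [Fintype α] (𝓘 : Finset (Finset α)) : rank 𝓘 ≤ Fintype.card α :=
  Finset.sup_le fun X _ => Finset.card_le_univ X

lemma exists_optValue_eq {α : Type u} {𝓘 : Finset (Finset α)} {r : ℕ} (h𝓘 : ∀ Y, Y ∈ 𝓘 ↔ Y.card ≤ r) (f : Finset α → ℝ) :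
    ∃ O : Finset α, O.card ≤ r ∧ optValue 𝓘 f = f O ∧ ∀ P : Finset α, P.card ≤ r → f P ≤ f O := by
  have hne : 𝓘.Nonempty := ⟨∅, (h𝓘 ∅).mpr (by simp)⟩
  obtain ⟨O, hO, hmax⟩ := Finset.exists_max_image 𝓘 f hne
  refine ⟨O, (h𝓘 O).mp hO, ?_, fun P hP => hmax P ((h𝓘 P).mpr hP)⟩
  refine IsGreatest.csSup_eq ⟨Set.mem_image_of_mem f hO, ?_⟩
  rintro _ ⟨P, hP, rfl⟩
  exact hmax P hP

/-! ### The guarantee for the whole algorithm. -/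

section Main

variable {α : Type u} [Fintype α] [DecidableEq α] [Nonempty α] {f : Finset α → ℝ}
  {𝓘 : Finset (Finset α)} {ε : ℝ} {r : ℕ}

/-- `ParSSP` starts with a best singleton, runs the loop over the thresholds, and returns the
better one of the two solutions. -/
lemma exists_parSSP_eq (hr : rank 𝓘 = r) (mode : SearchMode) :
    ∃ v : α, (∀ u, f {u} ≤ f {v}) ∧ ∀ φ : Finset α → ℝ,
      mean f (parSSP mode 𝓘 oneHalf ε) φ =
        mean f (parSSPLoop mode 𝓘 (f {v}) ε oneHalf ⌈(Real.logb (1 - ε) (ε / r) + 2) / ε ^ 2⌉₊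
          (⌈Real.logb (1 - ε) (ε / r)⌉₊ + 1) 0 ∅ univ)
          fun T => φ (if f {v} ≤ f T then T else {v}) := by
  set g : Finset α → ℝ := fun X =>
    if X ∈ univ.image (fun u : α => ({u} : Finset α)) then f X else 0 with hg
  have hgu : ∀ u, g {u} = f {u} := fun u => by simp [hg]
  refine ⟨argmax fun u => g {u}, fun u => ?_, fun φ => ?_⟩
  · have := argmax_spec (fun u => g {u}) u
    simpa only [hgu] using this
  · rw [parSSP, hr]
    change mean f ((parSSPLoop mode 𝓘 (g {argmax fun u => g {u}}) ε oneHalf _ _ 0 ∅ univ).bind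
      fun T => .query {T, {argmax fun u => g {u}}} fun g' =>
        .ret (if g' {argmax fun u => g {u}} ≤ g' T then T else {argmax fun u => g {u}})) φ = _
    rw [mean_bind, hgu]
    simp [mean]

lemma always_parSSP (h𝓘 : ∀ Y, Y ∈ 𝓘 ↔ Y.card ≤ r) (hr1 : 1 ≤ r) (mode : SearchMode) :
    Always f ((Fintype.card α + 1) ^ 2) (parSSP mode 𝓘 oneHalf ε) fun S => S ∈ 𝓘 := by
  have hN : 1 ≤ Fintype.card α := Fintype.card_pos
  refine ⟨Finset.card_image_le.trans (by rw [Finset.card_univ]; nlinarith), ?_⟩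
  refine (always_parSSPLoop h𝓘 (by rw [sq]) oneHalf _ _ _ (by simp) (by simp)
    (Finset.card_univ.le)).bind fun S hS => ⟨Finset.card_le_two.trans (by nlinarith), ?_⟩
  have key : ∀ (p : Prop) [Decidable p] (u : α), (if p then S else {u}) ∈ 𝓘 := by
    intro p _ u
    split_ifs
    · exact (h𝓘 _).mpr hS
    · exact (h𝓘 _).mpr (by simpa using hr1)
  exact key _ _

/-- After multiplication by `(1 - ε)^3` the terms of order 0 and 1 in `ε` cancel, and the difference
is `ε²` times a factor that is nonnegative on this range. -/
lemma ratio_bound (hε0 : 0 < ε) (hε1 : ε < 1 / 4) :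
    (((1 - ε) ^ 3)⁻¹ + 1 + ε) * (1 / 4 - ε) ≤ 1 / 2 - ε := by
  have hx0 : 0 < 1 - ε := by linarith
  have hx : 0 < (1 - ε) ^ 3 := by positivity
  have h1 : (((1 - ε) ^ 3)⁻¹ + 1 + ε) * (1 / 4 - ε) =
      ((1 + (1 + ε) * (1 - ε) ^ 3) * (1 / 4 - ε)) / (1 - ε) ^ 3 := by
    field_simp
    ring
  rw [h1, div_le_iff₀ hx]
  have h2 : (1 / 2 - ε) * (1 - ε) ^ 3 - (1 + (1 + ε) * (1 - ε) ^ 3) * (1 / 4 - ε) =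
      ε ^ 2 * (5 / 2 - 4 * ε + 13 / 4 * ε ^ 2 - ε ^ 3) := by ring
  have h3 : 0 ≤ 5 / 2 - 4 * ε + 13 / 4 * ε ^ 2 - ε ^ 3 := by nlinarith [pow_pos hε0 2]
  nlinarith [mul_nonneg (sq_nonneg ε) h3]

lemma le_mean_parSSP (hf : IsSubmodular f) (hf0 : ∀ X, 0 ≤ f X)
    (h𝓘 : ∀ Y, Y ∈ 𝓘 ↔ Y.card ≤ r) (hr : rank 𝓘 = r) (hr1 : 1 ≤ r) (hε0 : 0 < ε) (hε1 : ε < 1)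
    {O : Finset α} (hO : O.card ≤ r) (hopt : ∀ P : Finset α, P.card ≤ r → f P ≤ f O)
    (mode : SearchMode) :
    (1 / 4 - ε) * f O ≤ mean f (parSSP mode 𝓘 oneHalf ε) f := by
  obtain ⟨v, hv, hmean⟩ := exists_parSSP_eq (f := f) (ε := ε) hr mode
  rw [hmean]
  set lg := Real.logb (1 - ε) (ε / r) with hlg
  set loop := parSSPLoop mode 𝓘 (f {v}) ε oneHalf ⌈(lg + 2) / ε ^ 2⌉₊ (⌈lg⌉₊ + 1) 0 ∅ univ
    with hloop
  have hx : 0 < 1 - ε := by linarith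
  have hbest : ∀ T, f T ≤ f (if f {v} ≤ f T then T else {v}) ∧
      f {v} ≤ f (if f {v} ≤ f T then T else {v}) := by
    intro T
    split_ifs with h
    · exact ⟨le_rfl, h⟩
    · exact ⟨(not_le.mp h).le, le_rfl⟩
  set res := mean f loop fun T => f (if f {v} ≤ f T then T else {v}) with hres
  have hres1 : mean f loop f ≤ res := mean_mono_of_le fun T => (hbest T).1
  have hres2 : f {v} ≤ res :=
    (mean_const (f := f) loop (f {v})).symm.le.trans (mean_mono_of_le fun T => (hbest T).2)
  have hres0 : 0 ≤ res := (hf0 {v}).trans hres2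
  have hfO := hf0 O
  rcases le_or_gt (1 / 4) ε with hbig | hsmall
  · exact le_trans (mul_nonpos_of_nonpos_of_nonneg (by linarith) hfO) hres0
  -- If all singletons have value 0, submodularity gives `f O ≤ f ∅`. When `f ∅ > 0`, every
  -- singleton gain is negative, so the loop returns `∅`, which is optimal.
  rcases (hf0 {v}).eq_or_lt with hv0 | hvpos
  · have hOempty : f O ≤ f ∅ := by
      have h1 := hf.union_le ∅ O
      rw [Finset.empty_union] at h1
      have h2 : ∑ u ∈ O, gain f ∅ u ≤ 0 := Finset.sum_nonpos fun u _ => by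
        have e1 := hv u
        have e2 := hf0 ∅
        simp only [gain, insert_empty_eq]
        linarith
      linarith
    rcases (hf0 ∅).eq_or_lt with h0 | hpos
    · have : f O = 0 := by linarith
      rw [this, mul_zero]
      exact hres0
    · have : mean f loop f = f ∅ := by
        refine mean_parSSPLoop_of_not_valuable _ _ (fun j u _ h => ?_) f
        have e1 := hv u
        have e2 := h.1
        simp only [← hv0, zero_mul, gain, insert_empty_eq] at e1 e2
        linarith
      nlinarith
  · have hlg0 : 0 ≤ lg := logb_nonneg_of_rank hε0 hε1 hr1
    have hr0 : (0 : ℝ) < r := by exact_mod_cast hr1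
    have hMpos : 0 < ⌈(lg + 2) / ε ^ 2⌉₊ := Nat.ceil_pos.mpr (by positivity)
    -- The number of thresholds is chosen so that the last one is at most `ε / r` times `f {v}`.
    have hη : r * (f {v} * (1 - ε) ^ (0 + (⌈lg⌉₊ + 1)) / (1 - ε)) ≤ ε * f {v} := by
      have e1 : f {v} * (1 - ε) ^ (0 + (⌈lg⌉₊ + 1)) / (1 - ε) = f {v} * (1 - ε) ^ ⌈lg⌉₊ := by
        rw [zero_add, pow_succ]
        field_simp
      have e2 : (1 - ε) ^ ⌈lg⌉₊ ≤ ε / r := by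
        rw [← Real.rpow_natCast]
        refine (Real.rpow_le_rpow_of_exponent_ge hx (by linarith) (Nat.le_ceil lg)).trans_eq ?_
        exact Real.rpow_logb hx (by linarith) (by positivity)
      rw [e1]
      calc r * (f {v} * (1 - ε) ^ ⌈lg⌉₊) ≤ r * (f {v} * (ε / r)) := by gcongr
        _ = ε * f {v} := by field_simp
    have hmain := le_mean_parSSPLoop (mode := mode) (T := ∅) (I := univ) hf hf0 h𝓘 hε0 hε1 hMpos
      hopt hO hvpos (mul_nonneg hε0.le hvpos.le) (⌈lg⌉₊ + 1) 0 hη 0 0 le_rfl (by simp) (by simp)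
      (by simp [Finset.sdiff_eq_empty_iff_subset.mpr (Finset.subset_univ O)])
      (Or.inl ⟨fun u _ => by
        have e1 := hv u
        have e2 := hf0 ∅
        simp only [gain, insert_empty_eq, pow_zero, mul_one]
        have e3 := le_div_self hvpos.le hx (by linarith)
        linarith, by simp⟩)
    rw [← hloop, mean_sub, mean_add, mean_mul] at hmain
    -- The sampling bound is applied to `X ↦ f (O ∪ X)`, whose value at `∅` is `f O`.
    have hhalf : (1 - 1 / 2) * f (O ∪ ∅) ≤ mean f loop fun S => f (O ∪ S) := by
      refine le_mean_of_prob_le (hf.union_left O) (fun X => hf0 _) loop (fun S => S) (by norm_num)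
        fun u => ?_
      refine (mean_parSSPLoop_mem_le h𝓘 u _ _ _ (by simp) (by simp)).trans ?_
      simp
    rw [Finset.union_empty] at hhalf
    -- At most `lg + 2 ≤ ε² M` thresholds each lose `f O / (ε M)`; this is the reason for the choice
    -- of `M`.
    have hlost : ((⌈lg⌉₊ + 1 : ℕ) : ℝ) * (f O / (ε * ⌈(lg + 2) / ε ^ 2⌉₊)) ≤ ε * f O := by
      have e1 : ((⌈lg⌉₊ + 1 : ℕ) : ℝ) ≤ lg + 2 := by
        have := (Nat.ceil_lt_add_one hlg0).le
        push_cast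
        linarith
      have e2 := Nat.le_ceil ((lg + 2) / ε ^ 2)
      rw [div_le_iff₀ (by positivity)] at e2
      have hMpos' : (0 : ℝ) < ⌈(lg + 2) / ε ^ 2⌉₊ := by exact_mod_cast hMpos
      rw [← mul_div_assoc, div_le_iff₀ (by positivity)]
      have e3 := mul_le_mul_of_nonneg_right (e1.trans e2) hfO
      linarith
    have hy : 0 < ((1 - ε) ^ 3)⁻¹ := by positivity
    have hy0 : 0 ≤ ((1 - ε) ^ 3)⁻¹ * f ∅ := mul_nonneg hy.le (hf0 _)
    have hsum : (1 / 2 - ε) * f O ≤ (((1 - ε) ^ 3)⁻¹ + 1 + ε) * res := by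
      have e1 := mul_le_mul_of_nonneg_left hres1 hy.le
      have e2 := mul_le_mul_of_nonneg_left hres2 hε0.le
      linarith
    have hratio := mul_le_mul_of_nonneg_right (ratio_bound hε0 hsmall) hfO
    have hpos : 0 < ((1 - ε) ^ 3)⁻¹ + 1 + ε := by linarith
    refine le_of_mul_le_mul_left ?_ hpos
    linarith

lemma one_le_rank_cardFamily {B : ℝ} (hB : 1 ≤ B) : 1 ≤ rank (cardFamily α B) := by
  obtain ⟨u⟩ := (inferInstance : Nonempty α)
  have : ({u} : Finset α) ∈ cardFamily α B := by simpa [cardFamily] using hB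
  simpa using (mem_cardFamily_iff hB _).mp this

end Main

end LowAdaptivity

open LowAdaptivity in
theorem mainTheorem4 (ε : ℝ) (hε0 : 0 < ε) (hε1 : ε < 1) :
    ∃ C : ℝ, 0 < C ∧
      ∀ (α : Type*) [Fintype α] [DecidableEq α] [Nonempty α] (f : Finset α → ℝ) (B : ℝ),
        IsSubmodular f → (∀ X, 0 ≤ f X) → 1 ≤ B →
        ∀ (𝓘 : Finset (Finset α)) (n r : ℕ) (μ : SearchMode → PMF (Finset α × Cost)),
          𝓘 = cardFamily α B → n = Fintype.card α → r = rank 𝓘 →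
          (∀ mode, μ mode = (parSSP mode 𝓘 oneHalf ε).law f) →
          -- each run returns a feasible set and makes polynomially many queries per round
          (∀ mode, ∀ x ∈ (μ mode).support, x.1 ∈ 𝓘 ∧ x.2.maxBatch ≤ (n + 1) ^ 2) ∧
          -- the approximation guarantee
          (∀ mode, (1 / 4 - ε) * optValue 𝓘 f ≤ expect (μ mode) fun x => f x.1) ∧
          -- expected adaptivity and query complexity without binary search
          (expect (μ .exhaustive) (fun x => (x.2.rounds : ℝ)) ≤
            C * Real.log (n + 1) ^ 2) ∧
          (expect (μ .exhaustive) (fun x => (x.2.queries : ℝ)) ≤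
            C * (n * r * Real.log (n + 1) ^ 2)) ∧
          -- expected adaptivity and query complexity with binary search
          (expect (μ .binary) (fun x => (x.2.rounds : ℝ)) ≤
            C * (Real.log (n + 1) ^ 2 * Real.log (r + 1))) ∧
          (expect (μ .binary) (fun x => (x.2.queries : ℝ)) ≤
            C * (n * Real.log (n + 1) ^ 2 * Real.log (r + 1))) := by
  obtain ⟨C, hC, hbound⟩ := exists_total_cost_bound hε0 hε1
  -- The largest `κ₁ + κ₂` below is `24 + 4`, for the queries under binary search.
  refine ⟨28 * C, by positivity, ?_⟩
  intro α _ _ _ f B hf hf0 hB 𝓘 n r μ h𝓘B hn hr hμ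
  have h𝓘 : ∀ Y, Y ∈ 𝓘 ↔ Y.card ≤ r := fun Y => by
    rw [hr, h𝓘B]
    exact mem_cardFamily_iff hB Y
  have hr1 : 1 ≤ r := by
    rw [hr, h𝓘B]
    exact one_le_rank_cardFamily hB
  have hrn : r ≤ n := by
    rw [hr, hn]
    exact rank_le_card 𝓘
  -- `κ₁` bounds the cost of finding the indices and `κ₂` that of any other batch; `(s, t) = (1, 0)`
  -- counts rounds and `(0, 1)` queries.
  have hcost : ∀ (mode : SearchMode) (s t κ₁ κ₂ : ℝ), 0 ≤ κ₁ → 0 ≤ κ₂ →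
      (∀ (ρ : ℝ) (X L : Finset α) (V : List α), V.length ≤ r → V.length ≤ L.card →
        L.card ≤ n →
        (findIndices mode 𝓘 ρ ε X V L).meanCost (fun Q => s + t * Q.card) f ≤ κ₁) →
      (∀ Q : Finset (Finset α), Q.card ≤ n + 1 → s + t * Q.card ≤ κ₂) →
      expect (μ mode) (fun x => s * x.2.rounds + t * x.2.queries) ≤
        C * ((κ₁ + κ₂) * Real.log (n + 1) ^ 2) := by
    intro mode s t κ₁ κ₂ h1 h2 hfind hq
    rw [hμ, OracleAlg.expect_law_cost]
    subst hn
    exact (meanCost_parSSP_le h𝓘 hr.symm hε0 hε1 h1 h2 hfind hq).trans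
      (hbound _ _ _ _ hr1 hrn h1 h2)
  have hr1' : (1 : ℝ) ≤ r := by exact_mod_cast hr1
  have hrn' : (r : ℝ) ≤ n := by exact_mod_cast hrn
  have hlogr := half_le_log_add_one hr1
  set D := Real.log ((n : ℝ) + 1) with hD
  set E := Real.log ((r : ℝ) + 1) with hE
  have hCD : 0 ≤ C * D ^ 2 := by positivity
  refine ⟨fun mode x hx => ?_, fun mode => ?_, ?_, ?_, ?_, ?_⟩
  · rw [hμ] at hx
    have := (always_parSSP h𝓘 hr1 mode).of_mem_support hx
    rwa [← hn] at this
  · obtain ⟨O, hO, hOpt, hmax⟩ := exists_optValue_eq h𝓘 f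
    rw [hμ, hOpt, OracleAlg.expect_law_output]
    exact le_mean_parSSP hf hf0 h𝓘 hr.symm hr1 hε0 hε1 hO hmax mode
  · have := hcost .exhaustive 1 0 1 1 zero_le_one zero_le_one
      (fun ρ X L V _ _ _ => by rw [meanCost_findIndices_exhaustive]; simp) (fun Q _ => by simp)
    simp only [one_mul, zero_mul, add_zero] at this
    refine this.trans ?_
    nlinarith
  · have := hcost .exhaustive 0 1 (4 * (n * r)) (2 * (n * r)) (by positivity) (by positivity)
      (fun ρ X L V h1 h2 h3 => by
        rw [meanCost_findIndices_exhaustive, zero_add, one_mul]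
        have e1 : ((V.length + 1) * (L.card + 1) : ℕ) ≤ (r + 1) * (n + 1) :=
          Nat.mul_le_mul (by omega) (by omega)
        have e2 : ((((range (V.length + 1)).biUnion (probeSets X V L)).card : ℕ) : ℝ) ≤
            ((r + 1) * (n + 1) : ℕ) := by
          exact_mod_cast (card_biUnion_probeSets_le _).trans e1
        push_cast at e2
        nlinarith)
      (fun Q hQ => by
        have : (Q.card : ℝ) ≤ n + 1 := by exact_mod_cast hQ
        nlinarith)
    simp only [one_mul, zero_mul, zero_add] at this
    refine this.trans ?_
    have e3 : 0 ≤ C * D ^ 2 * (n * r) := by positivity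
    nlinarith
  · have := hcost .binary 1 0 (8 * E) (2 * E) (by linarith) (by linarith)
      (fun ρ X L V h1 _ _ => by
        refine (meanCost_findIndices_binary_le zero_le_one fun i _ => by simp).trans ?_
        have := natLog_add_one_le hr1 h1
        linarith)
      (fun Q _ => by simp; linarith)
    simp only [one_mul, zero_mul, add_zero] at this
    refine this.trans ?_
    have e3 : 0 ≤ C * D ^ 2 * E := mul_nonneg hCD (by linarith)
    nlinarith
  · have hn0 : (0 : ℝ) ≤ n := by linarith
    have hE0 : 0 ≤ E := by linarith
    have := hcost .binary 0 1 (24 * (n * E)) (4 * (n * E)) (by positivity) (by positivity)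
      (fun ρ X L V h1 h2 h3 => by
        refine (meanCost_findIndices_binary_le (κ := 3 * n) (by positivity) fun i hi => ?_).trans ?_
        · have e1 : (probeSets X V L i).card ≤ r + 1 + n :=
            (card_probeSets_le i).trans (by omega)
          have e2 : ((probeSets X V L i).card : ℝ) ≤ r + 1 + n := by exact_mod_cast e1
          linarith
        · have e1 := natLog_add_one_le hr1 h1
          have e2 := mul_le_mul_of_nonneg_right e1 hn0
          linarith)
      (fun Q hQ => by
        have e1 : (Q.card : ℝ) ≤ n + 1 := by exact_mod_cast hQ
        nlinarith)
    simp only [one_mul, zero_mul, zero_add] at this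
    refine this.trans ?_
    exact le_of_eq (by ring)
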